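/- **Theorem 3.1.** Let $d\in\{2,3\}$ and let $\Omega\subset\mathbb R^d$ be a bounded domain (open, connected) with Lipschitz boundary $\Gamma=\partial\Omega$, partitioned by a finite set $\mathcal T_h$ of (closed, possibly nonconvex) polygons ($d=2$) or polyhedra ($d=3$) with disjoint interiors. Let $\mathcal E_h$ be its finite set of edges or flat faces $e$: they are connected, overlap only in sets of zero surface measure, make up $\partial T$ for each $T\in\mathcal T_h$, and the ones contained in $\Gamma$ make up $\Gamma$. A face contained in $\Gamma$ belongs to exactly one element, and every other face is shared by exactly two. Write $h_T=\operatorname{diam}T$, let $\mathbf n$ be the outward unit normal on $\partial T$, and let $P_r$ denote polynomials of total degree at most $r$, with $P_r=\{0\}$ for $r<0$. Let $k\ge 1$ be an integer and let $\Gamma_d,\Gamma_n\subset\Gamma$ be resolved by the partition: up to sets of zero surface measure, each face contained in $\Gamma$ is contained in $\Gamma_d$ or disjoint from it, and likewise for $\Gamma_n$. Let $f\in L^2(\Omega)$, $g_1\in L^2(\Gamma_d)$, $g_2\in L^2(\Gamma_n)$. Let $V_h$ be the space of triples $v=\{v_0,v_b,v_n\mathbf n\}$ with $v_0|_T\in P_k(T)$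 for all $T\in\mathcal T_h$, and $v_b|_e\in P_k(e)$, $v_n|_e\in P_{k-1}(e)$ for all $e\in\mathcal E_h$, where $v_b$ and the vector $v_n\mathbf n$ have a common value on each face shared by two elements (so $v_n$ changes sign with $\mathbf n$). Let $$W_h=\{w:\ w|_T\in P_{k-2}(T)\ \ \forall T\in\mathcal T_h\},\qquad V_h^g=\{v\in V_h:\ v_b=Q_bg_1\text{ on }\Gamma_d,\ v_n=Q_ng_2\text{ on }\Gamma_n\},$$ where, on each face $e$, $Q_b$ and $Q_n$ are the $L^2$ projections onto $P_k(e)$ and $P_{k-1}(e)$; $V_h^0$ is $V_h^g$ for $g_1=g_2=0$. For $v\in V_h$ let $\Delta_{w,h}v\in W_h$ be determined on each $T$ by $$(\Delta_{w,h}v,\varphi)_T=(v_0,\Delta\varphi)_T-\langle v_b,\nabla\varphi\cdot\mathbf n\rangle_{\partial T}+\langle v_n,\varphi\rangle_{\partial T}\qquad\forall\varphi\in P_{k-2}(T),$$ and let $$s(\sigma,v)=\sum_{T\in\mathcal T_h}\Big(h_T^{-3}\int_{\partial T}(\sigma_0-\sigma_b)(v_0-v_b)\,ds+h_T^{-1}\int_{\partial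 T}(\nabla\sigma_0\cdot\mathbf n-\sigma_n)(\nabla v_0\cdot\mathbf n-v_n)\,ds\Big).$$ Assume that $\Gamma_d\cap\Gamma_n$ has positive surface measure and that $\Gamma_d\cup\Gamma_n$ is a closed proper subset of $\Gamma$. Then there is exactly one pair $(u_h,\lambda_h)\in V_h^g\times W_h$ such that $$s(u_h,v)+(\Delta_{w,h}v,\lambda_h)=0\quad\forall v\in V_h^0,\qquad (\Delta_{w,h}u_h,w)=(f,w)\quad\forall w\in W_h.$$ -/

import Mathlib

open MeasureTheory
open scoped Topology

noncomputable section

namespace PDWG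

/-- Euclidean space `ℝ^d`. The surface measure (arc length for `d = 2`, area for `d = 3`) is
`μHE[d - 1]`, the Hausdorff measure normalised so as to agree with Lebesgue measure on
`(d - 1)`-dimensional affine subspaces. -/
abbrev Pt (d : ℕ) := EuclideanSpace ℝ (Fin d)

/-! ### Polynomials -/

/-- Real polynomials in `d` variables. -/
abbrev Poly (d : ℕ) := MvPolynomial (Fin d) ℝ

/-- `P_r`: the polynomials of total degree at most `r`. For negative `r` this is `{0}`. -/
def polySpace (d : ℕ) (r : ℤ) : Submodule ℝ (Poly d) :=
  MvPolynomial.restrictSupport ℝ {a : Fin d →₀ ℕ | ((∑ i, a i : ℕ) : ℤ) ≤ r}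

/-- Value of a polynomial at a point. -/
def evalAt {d : ℕ} (p : Poly d) (x : Pt d) : ℝ := MvPolynomial.eval (fun i => x i) p

/-- The Laplacian of a polynomial. -/
def lap {d : ℕ} (p : Poly d) : Poly d := ∑ i, MvPolynomial.pderiv i (MvPolynomial.pderiv i p)

/-- The directional derivative `∇p(x) · n`. -/
def dirDeriv {d : ℕ} (p : Poly d) (n x : Pt d) : ℝ := ∑ i, evalAt (MvPolynomial.pderiv i p) x * n i

/-- `P_r(S)`: the functions on `S` that are restrictions of polynomials of degree at most `r`. -/
def polyOn {d : ℕ} (S : Set (Pt d)) (r : ℤ) : Set (S → ℝ) :=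
  {q | ∃ p ∈ polySpace d r, ∀ x : S, q x = evalAt p x}

/-! ### Polytopal partitions -/

/-- `S` is a finite nonempty union of nondegenerate `m`-dimensional simplices, that is, a compact
and possibly nonconvex polyhedral set of pure dimension `m`. -/
def IsPolyhedral {d : ℕ} (m : ℕ) (S : Set (Pt d)) : Prop :=
  ∃ 𝒮 : Set (Affine.Simplex ℝ (Pt d) m), 𝒮.Finite ∧ 𝒮.Nonempty ∧
    S = ⋃ s ∈ 𝒮, convexHull ℝ (Set.range s.points)

/-- `n` is the outward unit normal of `T` along the flat piece `e` of its boundary: `e` lies in a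
hyperplane orthogonal to `n`, and at almost every point of `e`, `T` lies on the side of `-n`. -/
structure IsOutwardUnitNormal {d : ℕ} (T e : Set (Pt d)) (n : Pt d) : Prop where
  norm_eq_one : ‖n‖ = 1
  orthogonal : ∀ x ∈ e, ∀ y ∈ e, inner ℝ n (x - y) = 0
  outward : ∀ᵐ x ∂((μHE[d - 1] : Measure (Pt d)).restrict e),
    ∀ᶠ t in 𝓝[>] (0 : ℝ), x - t • n ∈ interior T ∧ x + t • n ∉ T

/-- A finite element partition of `Ω` into (closed, possibly nonconvex) polygons, `d = 2`, or
polyhedra, `d = 3`, with its set of edges/flat faces. A face `e` belongs to the boundary of the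
element `T` when `e ⊆ frontier T`. Hanging nodes are allowed: a straight piece of `frontier T` may
be subdivided into several faces, one for each neighbour. -/
structure PolytopalMesh {d : ℕ} (Ω : Set (Pt d)) where
  /-- The elements. -/
  elems : Finset (Set (Pt d))
  /-- The edges (`d = 2`) or flat faces (`d = 3`). -/
  faces : Finset (Set (Pt d))
  /-- `normal T e` is the outward unit normal of `T` on `e` (only used if `e ⊆ frontier T`). -/
  normal : Set (Pt d) → Set (Pt d) → Pt d
  elem_polyhedral : ∀ T ∈ elems, IsPolyhedral d T
  elem_connected : ∀ T ∈ elems, IsConnected (interior T)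
  elem_disjoint : ∀ T ∈ elems, ∀ T' ∈ elems, T ≠ T' → Disjoint (interior T) (interior T')
  iUnion_elems : ⋃ T ∈ elems, T = closure Ω
  face_polyhedral : ∀ e ∈ faces, IsPolyhedral (d - 1) e
  face_connected : ∀ e ∈ faces, IsConnected e
  /-- Distinct faces do not overlap. -/
  face_disjoint : ∀ e ∈ faces, ∀ e' ∈ faces, e ≠ e' →
    (μHE[d - 1] : Measure (Pt d)) (e ∩ e') = 0
  isOutwardUnitNormal : ∀ T ∈ elems, ∀ e ∈ faces, e ⊆ frontier T →
    IsOutwardUnitNormal T e (normal T e)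
  /-- The boundary of each element is the union of its faces. -/
  frontier_elem : ∀ T ∈ elems, frontier T = ⋃ e ∈ {e | e ∈ faces ∧ e ⊆ frontier T}, e
  /-- The boundary of the domain is the union of the boundary faces. -/
  frontier_domain : frontier Ω = ⋃ e ∈ {e | e ∈ faces ∧ e ⊆ frontier Ω}, e
  /-- A boundary face belongs to exactly one element. -/
  boundary_face : ∀ e ∈ faces, e ⊆ frontier Ω → {T | T ∈ elems ∧ e ⊆ frontier T}.ncard = 1
  /-- An interior face is shared by exactly two elements. -/
  interior_face : ∀ e ∈ faces, ¬ e ⊆ frontier Ω → {T | T ∈ elems ∧ e ⊆ frontier T}.ncard = 2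

namespace PolytopalMesh

variable {d : ℕ} {Ω : Set (Pt d)} (M : PolytopalMesh Ω)

/-! ### Integrals -/

/-- The surface measure on the face `e`. -/
def faceMeasure (e : Set (Pt d)) : Measure e :=
  (μHE[d - 1] : Measure (Pt d)).comap (Subtype.val : e → Pt d)

open Classical in
/-- `∫_{∂T} F ds`, where `F` is given separately on each face. -/
def boundaryIntegral (T : Set (Pt d)) (F : (e : M.faces) → e.1 → ℝ) : ℝ :=
  ∑ e : M.faces with e.1 ⊆ frontier T, ∫ x, F e x ∂(faceMeasure e.1)

/-! ### Weak functions -/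

/-- Piecewise polynomials, one on each element. As elements have nonempty interior, a polynomial
is identified with its restriction to the element. -/
abbrev PiecewisePoly := M.elems → Poly d

/-- Triples `{v₀, v_b, v_n n}`: `v₀` is a polynomial on each element, `v_b` a real function on each
face, and `v_n n` a vector field on each face; the last two are single valued, that is, common to
the elements that share the face. -/
abbrev WeakFunction :=
  M.PiecewisePoly × ((e : M.faces) → e.1 → ℝ) × ((e : M.faces) → e.1 → Pt d)

variable {M} in
/-- The interior component `v₀`. -/
def WeakFunction.v0 (v : M.WeakFunction) (T : M.elems) : Poly d := v.1 T

variable {M} in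
/-- The boundary component `v_b`. -/
def WeakFunction.vb (v : M.WeakFunction) (e : M.faces) (x : e.1) : ℝ := v.2.1 e x

variable {M} in
/-- The vector-valued component `v_n n`. -/
def WeakFunction.vnn (v : M.WeakFunction) (e : M.faces) (x : e.1) : Pt d := v.2.2 e x

variable {M} in
/-- The scalar `v_n` as seen from the element `T`: the component of `v_n n` along the outward
normal of `T`. -/
def WeakFunction.vn (v : M.WeakFunction) (T : M.elems) (e : M.faces) (x : e.1) : ℝ :=
  inner ℝ (v.vnn e x) (M.normal T.1 e.1)

/-- The weak finite element space `V_h`: `v₀ ∈ P_k(T)`, `v_b ∈ P_k(e)`, and `v_n n` is normal to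
`e` with `v_n ∈ P_{k-1}(e)`. -/
def Vh (k : ℕ) : Set M.WeakFunction :=
  {v | (∀ T, v.v0 T ∈ polySpace d k) ∧
    (∀ e, v.vb e ∈ polyOn e.1 k) ∧
    (∀ (T : M.elems) (e : M.faces), e.1 ⊆ frontier T.1 →
      v.vn T e ∈ polyOn e.1 ((k : ℤ) - 1) ∧
      ∀ x, v.vnn e x = v.vn T e x • M.normal T.1 e.1)}

/-- The space `W_h` of piecewise polynomials of degree at most `k - 2` (`{0}` for `k = 1`). -/
def Wh (k : ℕ) : Set M.PiecewisePoly := {w | ∀ T, w T ∈ polySpace d ((k : ℤ) - 2)}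

/-- `q` is the `L²` projection of `g` onto `P_r(e)`. -/
def IsL2Projection (e : Set (Pt d)) (r : ℤ) (g : Pt d → ℝ) (q : e → ℝ) : Prop :=
  q ∈ polyOn e r ∧ ∀ φ ∈ polyOn e r, ∫ x, (g x - q x) * φ x ∂(faceMeasure e) = 0

/-- The partition resolves the boundary portion `Γ`: up to a set of surface measure zero, each
boundary face is either contained in `Γ` or disjoint from it. -/
def Resolves (Γ : Set (Pt d)) : Prop :=
  ∀ e ∈ M.faces, e ⊆ frontier Ω →
    (μHE[d - 1] : Measure (Pt d)) (e \ Γ) = 0 ∨ (μHE[d - 1] : Measure (Pt d)) (e ∩ Γ) = 0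

/-- `e` is one of the faces that make up `Γ`. -/
def IsFaceOf (Γ e : Set (Pt d)) : Prop :=
  e ⊆ frontier Ω ∧ (μHE[d - 1] : Measure (Pt d)) (e \ Γ) = 0

/-- The hyperplane `V_h^g` of the `v ∈ V_h` with `v_b = Q_b g₁` on `Γ_d` and `v_n = Q_n g₂` on
`Γ_n`. -/
def Vhg (k : ℕ) (Γd Γn : Set (Pt d)) (g₁ g₂ : Pt d → ℝ) : Set M.WeakFunction :=
  {v | v ∈ M.Vh k ∧
    (∀ e : M.faces, IsFaceOf (Ω := Ω) Γd e.1 → IsL2Projection e.1 k g₁ (v.vb e)) ∧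
    (∀ e : M.faces, IsFaceOf (Ω := Ω) Γn e.1 →
      ∀ T : M.elems, e.1 ⊆ frontier T.1 → IsL2Projection e.1 ((k : ℤ) - 1) g₂ (v.vn T e))}

/-- The subspace `V_h^0`. -/
def Vh0 (k : ℕ) (Γd Γn : Set (Pt d)) : Set M.WeakFunction := M.Vhg k Γd Γn 0 0

/-! ### The discrete weak Laplacian and the scheme -/

/-- `q ∈ P_r(T)` satisfies
`(q, φ)_T = (v₀, Δφ)_T - ⟨v_b, ∇φ · n⟩_{∂T} + ⟨v_n, φ⟩_{∂T}` for all `φ ∈ P_r(T)`. -/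
def IsDiscreteWeakLaplacian (r : ℤ) (T : M.elems) (v : M.WeakFunction) (q : Poly d) : Prop :=
  q ∈ polySpace d r ∧ ∀ φ ∈ polySpace d r,
    ∫ x in T.1, evalAt q x * evalAt φ x =
      (∫ x in T.1, evalAt (v.v0 T) x * evalAt (lap φ) x)
        - M.boundaryIntegral T.1 (fun e x => v.vb e x * dirDeriv φ (M.normal T.1 e.1) x)
        + M.boundaryIntegral T.1 (fun e x => v.vn T e x * evalAt φ x)

open Classical in
/-- The discrete weak Laplacian `Δ_{w,r,T} v`: the unique polynomial in `P_r(T)` with the above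
property. -/
def weakLaplacian (r : ℤ) (T : M.elems) (v : M.WeakFunction) : Poly d :=
  if h : ∃ q, M.IsDiscreteWeakLaplacian r T v q then h.choose else 0

/-- `Δ_{w,h} v`, computed element by element with `r = k - 2`. -/
def weakLaplacianH (k : ℕ) (v : M.WeakFunction) : M.PiecewisePoly :=
  fun T => M.weakLaplacian ((k : ℤ) - 2) T v

/-- The `L²(Ω)` inner product of two piecewise polynomials. -/
def innerPP (p w : M.PiecewisePoly) : ℝ := ∑ T : M.elems, ∫ x in T.1, evalAt (p T) x * evalAt (w T) x

/-- The `L²(Ω)` inner product `(f, w)`, with `w` a piecewise polynomial. -/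
def load (f : Pt d → ℝ) (w : M.PiecewisePoly) : ℝ := ∑ T : M.elems, ∫ x in T.1, f x * evalAt (w T) x

/-- The local stabilizer `s_T(σ, v)`; here `h_T` is the diameter of `T`. -/
def stabT (T : M.elems) (σ v : M.WeakFunction) : ℝ :=
  (Metric.diam T.1 ^ 3)⁻¹ * M.boundaryIntegral T.1 (fun e x =>
      (evalAt (σ.v0 T) x - σ.vb e x) * (evalAt (v.v0 T) x - v.vb e x))
  + (Metric.diam T.1)⁻¹ * M.boundaryIntegral T.1 (fun e x =>
      (dirDeriv (σ.v0 T) (M.normal T.1 e.1) x - σ.vn T e x) *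
        (dirDeriv (v.v0 T) (M.normal T.1 e.1) x - v.vn T e x))

/-- The stabilizer `s(σ, v)`. -/
def stab (σ v : M.WeakFunction) : ℝ := ∑ T : M.elems, M.stabT T σ v

/-- `(u, lam)` solves the primal-dual weak Galerkin scheme of order `k` for the data
`f`, `g₁` on `Γ_d`, `g₂` on `Γ_n`. -/
structure IsSolution (k : ℕ) (Γd Γn : Set (Pt d)) (f g₁ g₂ : Pt d → ℝ)
    (u : M.WeakFunction) (lam : M.PiecewisePoly) : Prop where
  u_mem : u ∈ M.Vhg k Γd Γn g₁ g₂
  lam_mem : lam ∈ M.Wh k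
  dual_eq : ∀ v ∈ M.Vh0 k Γd Γn, M.stab u v + M.innerPP (M.weakLaplacianH k v) lam = 0
  primal_eq : ∀ w ∈ M.Wh k, M.innerPP (M.weakLaplacianH k u) w = M.load f w

end PolytopalMesh

end PDWG

end

/-!
The system is linear, square and finite dimensional, so it is enough to show that the homogeneous
problem has only the zero solution `(u, λ)`. Testing with `(u, -λ)` gives `s(u, u) = 0`, so `u_b`
and `u_n` are the traces of `u₀` and `∇u₀ · n` from either side of every face. Green's formula then
turns the second equation into `(Δu₀, w)_T = 0`, and since `Δu₀` is itself an admissible `w`, each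
`u₀|_T` is harmonic. A harmonic polynomial with zero Cauchy data on a flat piece of positive
measure is zero. Hence `u₀` vanishes on the element at a face of `Γ_d ∩ Γ_n`, and, Cauchy data
being shared across interior faces, on every neighbour in turn; connectedness of `Ω` reaches all
elements. The first equation is now `(Δ_w v, λ) = 0`; taking for `v₀` the Laplacian of `λ` and for
`v_b`, `v_n` the jumps of `∇λ · n` and `λ`, one finds that `λ` is piecewise harmonic, does not jump,
and has zero Cauchy data on a face outside `Γ_d ∪ Γ_n`, so it vanishes for the same reason.
-/

noncomputable section

namespace PDWG

/-! ### Polynomials as functions -/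

section Polynomials

variable {d : ℕ}

lemma analyticOnNhd_evalAt (p : Poly d) : AnalyticOnNhd ℝ (evalAt p) Set.univ := fun x _ =>
  AnalyticAt.aeval_mvPolynomial (𝕜 := ℝ) (f := fun (y : Pt d) (i : Fin d) => y i)
    (fun i => (EuclideanSpace.proj (𝕜 := ℝ) i : Pt d →L[ℝ] ℝ).analyticAt x) p

@[fun_prop]
lemma contDiff_evalAt (p : Poly d) {n : WithTop ℕ∞} : ContDiff ℝ n (evalAt p) :=
  (analyticOnNhd_evalAt p).contDiff

@[fun_prop]
lemma continuous_evalAt (p : Poly d) : Continuous (evalAt p) :=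
  (contDiff_evalAt p (n := 0)).continuous

@[simp]
lemma evalAt_zero (x : Pt d) : evalAt (0 : Poly d) x = 0 := by simp [evalAt]

@[simp]
lemma evalAt_add (p q : Poly d) (x : Pt d) : evalAt (p + q) x = evalAt p x + evalAt q x := by
  simp [evalAt]

@[simp]
lemma evalAt_sub (p q : Poly d) (x : Pt d) : evalAt (p - q) x = evalAt p x - evalAt q x := by
  simp [evalAt]

@[simp]
lemma evalAt_mul (p q : Poly d) (x : Pt d) : evalAt (p * q) x = evalAt p x * evalAt q x := by
  simp [evalAt]

@[simp]
lemma evalAt_smul (c : ℝ) (p : Poly d) (x : Pt d) : evalAt (c • p) x = c * evalAt p x := by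
  simp [evalAt]

@[simp]
lemma evalAt_sum {ι : Type*} (s : Finset ι) (p : ι → Poly d) (x : Pt d) :
    evalAt (∑ i ∈ s, p i) x = ∑ i ∈ s, evalAt (p i) x := by
  simp [evalAt]

lemma eq_zero_of_evalAt_eq_zero {p : Poly d} (h : ∀ x, evalAt p x = 0) : p = 0 :=
  MvPolynomial.funext fun x => by simpa [evalAt] using h (WithLp.toLp 2 x)

/-- The directional derivative of polynomials, as a derivation depending linearly on the
direction. -/
def dirDerivation : Pt d →ₗ[ℝ] Derivation ℝ (Poly d) (Poly d) :=
  ∑ i, (EuclideanSpace.proj i : Pt d →L[ℝ] ℝ).toLinearMap.smulRight (MvPolynomial.pderiv i)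

lemma dirDerivation_apply (v : Pt d) (p : Poly d) :
    dirDerivation v p = ∑ i, v i • MvPolynomial.pderiv i p := by
  rw [dirDerivation, LinearMap.sum_apply, ← Derivation.coeFnAddMonoidHom_apply, map_sum,
    Finset.sum_apply]
  simp [Derivation.coeFnAddMonoidHom_apply]

lemma evalAt_dirDerivation (v x : Pt d) (p : Poly d) :
    evalAt (dirDerivation v p) x = dirDeriv p v x := by
  simp [dirDerivation_apply, dirDeriv, mul_comm]

lemma dirDerivation_X (v : Pt d) (i : Fin d) :
    dirDerivation v (MvPolynomial.X i) = MvPolynomial.C (v i) := by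
  simp [dirDerivation_apply, MvPolynomial.pderiv_X, Pi.single_apply, MvPolynomial.smul_eq_C_mul]

lemma dirDerivation_single (i : Fin d) (p : Poly d) :
    dirDerivation (EuclideanSpace.single i 1) p = MvPolynomial.pderiv i p := by
  simp [dirDerivation_apply]

lemma dirDerivation_comm (v w : Pt d) (p : Poly d) :
    dirDerivation v (dirDerivation w p) = dirDerivation w (dirDerivation v p) := by
  have h : ⁅dirDerivation v, dirDerivation w⁆ = 0 := by
    refine MvPolynomial.derivation_ext fun i => ?_
    simp [Derivation.commutator_apply, dirDerivation_X]
  simpa [Derivation.commutator_apply, sub_eq_zero] using DFunLike.congr_fun h p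

lemma lap_eq_sum_dirDerivation (p : Poly d) :
    lap p = ∑ i, dirDerivation (EuclideanSpace.single i 1)
      (dirDerivation (EuclideanSpace.single i 1) p) := by
  simp only [lap, dirDerivation_single]

lemma lap_dirDerivation (v : Pt d) (p : Poly d) :
    lap (dirDerivation v p) = dirDerivation v (lap p) := by
  simp only [lap_eq_sum_dirDerivation, map_sum]
  exact Finset.sum_congr rfl fun i _ => by rw [dirDerivation_comm _ v, dirDerivation_comm _ v]

lemma hasDerivAt_evalAt_line (p : Poly d) (x v : Pt d) (t : ℝ) :
    HasDerivAt (fun s : ℝ => evalAt p (x + s • v)) (dirDeriv p v (x + t • v)) t := by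
  simp only [← evalAt_dirDerivation]
  induction p using MvPolynomial.induction_on with
  | C a => simpa [evalAt, dirDerivation_apply] using hasDerivAt_const t a
  | add p q hp hq =>
    simp only [map_add, evalAt_add]
    exact hp.add hq
  | mul_X p i hp =>
    have hX : HasDerivAt (fun s : ℝ => evalAt (MvPolynomial.X i : Poly d) (x + s • v)) (v i) t := by
      simpa [evalAt] using ((hasDerivAt_id t).mul_const (v i)).const_add (x i)
    simp only [Derivation.leibniz, dirDerivation_X, smul_eq_mul, evalAt_add, evalAt_mul]
    refine (hp.mul hX).congr_deriv ?_
    simp only [evalAt, MvPolynomial.eval_C]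
    ring

lemma fderiv_evalAt (p : Poly d) (x v : Pt d) : fderiv ℝ (evalAt p) x v = dirDeriv p v x := by
  have hdiff : DifferentiableAt ℝ (evalAt p) x :=
    (contDiff_evalAt p (n := 1)).differentiable one_ne_zero x
  rw [← hdiff.lineDeriv_eq_fderiv]
  simpa [lineDeriv] using (hasDerivAt_evalAt_line p x v 0).deriv

lemma evalAt_add_smul_of_dirDerivation_eq_zero {v : Pt d} {p : Poly d}
    (h : dirDerivation v p = 0) (x : Pt d) (t : ℝ) : evalAt p (x + t • v) = evalAt p x := by
  have hderiv (s : ℝ) : HasDerivAt (fun s : ℝ => evalAt p (x + s • v)) 0 s := by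
    simpa only [← evalAt_dirDerivation, h, evalAt_zero] using hasDerivAt_evalAt_line p x v s
  simpa using is_const_of_deriv_eq_zero (fun s => (hderiv s).differentiableAt)
    (fun s => (hderiv s).deriv) t 0

lemma polySpace_mono {r s : ℤ} (h : r ≤ s) : polySpace d r ≤ polySpace d s :=
  MvPolynomial.restrictSupport_mono _ fun _ ha => le_trans ha h

lemma eq_zero_of_mem_polySpace_of_neg {r : ℤ} (hr : r < 0) {p : Poly d} (hp : p ∈ polySpace d r) :
    p = 0 := by
  rw [polySpace, MvPolynomial.mem_restrictSupport_iff] at hp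
  rw [← MvPolynomial.support_eq_empty, Finset.eq_empty_iff_forall_notMem]
  intro a ha
  exact absurd (hp ha) (not_le.2 (hr.trans_le (Int.natCast_nonneg _)))

lemma exists_mem_polySpace (p : Poly d) : ∃ m : ℕ, p ∈ polySpace d m := by
  refine ⟨p.support.sup fun a => ∑ i, a i,
    (MvPolynomial.mem_restrictSupport_iff ℝ).2 fun a ha => ?_⟩
  exact Int.ofNat_le.2 (Finset.le_sup (f := fun a : Fin d →₀ ℕ => ∑ i, a i) ha)

lemma pderiv_monomial_mem_polySpace {r : ℤ} {a : Fin d →₀ ℕ} (ha : ((∑ i, a i : ℕ) : ℤ) ≤ r)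
    (i : Fin d) (c : ℝ) :
    MvPolynomial.pderiv i (MvPolynomial.monomial a c) ∈ polySpace d (r - 1) := by
  rw [MvPolynomial.pderiv_monomial]
  refine (MvPolynomial.monomial_mem_restrictSupport ℝ).2 ?_
  rcases eq_or_ne (a i) 0 with h | h
  · exact Or.inr (by simp [h])
  · have hsum : ∑ j, a j = ∑ j, (a - Finsupp.single i 1 : Fin d →₀ ℕ) j + 1 := by
      conv_lhs =>
        rw [← tsub_add_cancel_of_le (Finsupp.single_le_iff.2 (Nat.one_le_iff_ne_zero.2 h))]
      simp only [Finsupp.add_apply, Finset.sum_add_distrib]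
      simp [Finsupp.single_apply]
    left
    simp only [Set.mem_ofPred_eq]
    omega

lemma pderiv_mem_polySpace {r : ℤ} {p : Poly d} (hp : p ∈ polySpace d r) (i : Fin d) :
    MvPolynomial.pderiv i p ∈ polySpace d (r - 1) := by
  rw [polySpace, MvPolynomial.restrictSupport_eq_span] at hp
  induction hp using Submodule.span_induction with
  | mem x hx =>
    obtain ⟨a, ha, rfl⟩ := hx
    exact pderiv_monomial_mem_polySpace ha i 1
  | zero => simp
  | add x y _ _ hx hy => rw [map_add]; exact add_mem hx hy
  | smul c x _ hx => rw [Derivation.map_smul]; exact Submodule.smul_mem _ c hx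

lemma dirDerivation_mem_polySpace {r : ℤ} {p : Poly d} (hp : p ∈ polySpace d r) (v : Pt d) :
    dirDerivation v p ∈ polySpace d (r - 1) := by
  rw [dirDerivation_apply]
  exact Submodule.sum_mem _ fun i _ => Submodule.smul_mem _ _ (pderiv_mem_polySpace hp i)

lemma lap_mem_polySpace {r : ℤ} {p : Poly d} (hp : p ∈ polySpace d r) :
    lap p ∈ polySpace d (r - 2) := by
  rw [show r - 2 = r - 1 - 1 by ring]
  exact Submodule.sum_mem _ fun i _ => pderiv_mem_polySpace (pderiv_mem_polySpace hp i) i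

instance finiteDimensional_polySpace (r : ℤ) : FiniteDimensional ℝ (polySpace d r) := by
  have hfin : {a : Fin d →₀ ℕ | ((∑ i, a i : ℕ) : ℤ) ≤ r}.Finite := by
    have hbox : ((Set.univ : Set (Fin d)).pi fun _ => Set.Iic r.toNat).Finite :=
      Set.Finite.pi fun _ => Set.finite_Iic _
    refine Set.Finite.of_finite_image (hbox.subset ?_) (f := fun a : Fin d →₀ ℕ => (a : Fin d → ℕ))
      DFunLike.coe_injective.injOn
    rintro _ ⟨a, ha, rfl⟩ i _
    have : a i ≤ ∑ j, a j := Finset.single_le_sum (f := fun j => a j) (fun _ _ => Nat.zero_le _)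
      (Finset.mem_univ i)
    simp only [Set.mem_ofPred_eq, Set.mem_Iic] at ha ⊢
    omega
  have := hfin.to_subtype
  exact Module.Finite.of_basis (MvPolynomial.basisRestrictSupport ℝ _)

end Polynomials

/-! ### Cauchy uniqueness for harmonic polynomials -/

section Cauchy

variable {d : ℕ} {p : Poly d} {x₀ : Pt d}

lemma evalAt_eq_zero_of_eventually {V : Submodule ℝ (Pt d)} {w₀ : V}
    (h : ∀ᶠ w : V in 𝓝 w₀, evalAt p (x₀ + w) = 0) : ∀ w ∈ V, evalAt p (x₀ + w) = 0 := by
  have han : AnalyticOnNhd ℝ (fun w : V => evalAt p (x₀ + w)) Set.univ := by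
    intro w _
    have hshift : AnalyticAt ℝ (fun w : V => x₀ + (w : Pt d)) w :=
      analyticAt_const.add (V.subtypeL.analyticAt w)
    exact AnalyticAt.comp (g := evalAt p) (analyticOnNhd_evalAt p _ (Set.mem_univ _)) hshift
  have hzero := han.eqOn_zero_of_preconnected_of_eventuallyEq_zero isPreconnected_univ
    (Set.mem_univ w₀) h
  exact fun w hw => by simpa only [Pi.zero_apply] using hzero (Set.mem_univ (⟨w, hw⟩ : V))

lemma evalAt_dirDerivation_eq_zero {V : Submodule ℝ (Pt d)}
    (h : ∀ w ∈ V, evalAt p (x₀ + w) = 0) {u : Pt d} (hu : u ∈ V) :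
    ∀ w ∈ V, evalAt (dirDerivation u p) (x₀ + w) = 0 := by
  intro w hw
  have hconst : (fun s : ℝ => evalAt p (x₀ + w + s • u)) = fun _ => 0 := by
    funext s
    rw [add_assoc]
    exact h _ (V.add_mem hw (V.smul_mem s hu))
  have hderiv := hasDerivAt_evalAt_line p (x₀ + w) u 0
  rw [hconst] at hderiv
  simpa [evalAt_dirDerivation] using hderiv.unique (hasDerivAt_const 0 0)

lemma lap_eq_normal_add_tangential {n : Pt d} (hn : ‖n‖ = 1) (p : Poly d) :
    lap p = dirDerivation n (dirDerivation n p) +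
      ∑ i, dirDerivation (EuclideanSpace.single i 1 - n i • n)
        (dirDerivation (EuclideanSpace.single i 1 - n i • n) p) := by
  have hn2 : ∑ i, n i * n i = 1 := by
    simpa [hn, pow_two] using (EuclideanSpace.real_norm_sq_eq n).symm
  have hnormal (q : Poly d) :
      ∑ i, n i • dirDerivation (EuclideanSpace.single i 1) q = dirDerivation n q := by
    simp only [dirDerivation_single, dirDerivation_apply n]
  have hcross : ∑ i, n i • dirDerivation n (dirDerivation (EuclideanSpace.single i 1) p) =
      dirDerivation n (dirDerivation n p) := by
    rw [← hnormal]
    exact Finset.sum_congr rfl fun i _ => by rw [dirDerivation_comm]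
  simp only [map_sub, map_smul, Derivation.sub_apply, Derivation.smul_apply, Derivation.map_smul,
    smul_sub, Finset.sum_sub_distrib, smul_smul]
  rw [hnormal, hcross, ← Finset.sum_smul, hn2, one_smul, lap_eq_sum_dirDerivation]
  abel

lemma single_sub_smul_mem_orthogonal {n : Pt d} (hn : ‖n‖ = 1) (i : Fin d) :
    EuclideanSpace.single i 1 - n i • n ∈ (ℝ ∙ n)ᗮ := by
  rw [Submodule.mem_orthogonal_singleton_iff_inner_right]
  simp [inner_sub_right, inner_smul_right, hn, EuclideanSpace.inner_single_right]

lemma evalAt_normal_normal_eq_zero {n : Pt d} (hn : ‖n‖ = 1) (hlap : lap p = 0)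
    (h : ∀ w ∈ (ℝ ∙ n)ᗮ, evalAt p (x₀ + w) = 0) :
    ∀ w ∈ (ℝ ∙ n)ᗮ, evalAt (dirDerivation n (dirDerivation n p)) (x₀ + w) = 0 := by
  intro w hw
  have htangential : ∑ i, evalAt (dirDerivation (EuclideanSpace.single i 1 - n i • n)
      (dirDerivation (EuclideanSpace.single i 1 - n i • n) p)) (x₀ + w) = 0 :=
    Finset.sum_eq_zero fun i _ =>
      have hi := single_sub_smul_mem_orthogonal hn i
      evalAt_dirDerivation_eq_zero (evalAt_dirDerivation_eq_zero h hi) hi w hw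
  have hsplit : evalAt (lap p) (x₀ + w) = 0 := by rw [hlap, evalAt_zero]
  rwa [lap_eq_normal_add_tangential hn, evalAt_add, evalAt_sum, htangential, add_zero] at hsplit

lemma eq_zero_of_dirDerivation_eq_zero {n : Pt d} (hn : ‖n‖ = 1) (hp : dirDerivation n p = 0)
    (h : ∀ w ∈ (ℝ ∙ n)ᗮ, evalAt p (x₀ + w) = 0) : p = 0 := by
  refine eq_zero_of_evalAt_eq_zero fun x => ?_
  set s := inner ℝ n (x - x₀)
  have hw : x - x₀ - s • n ∈ (ℝ ∙ n)ᗮ := by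
    rw [Submodule.mem_orthogonal_singleton_iff_inner_right, inner_sub_right, inner_smul_right,
      real_inner_self_eq_norm_sq, hn]
    simp [s]
  have hx : x₀ + (x - x₀ - s • n) + s • n = x := by abel
  rw [← hx, evalAt_add_smul_of_dirDerivation_eq_zero hp, h _ hw]

/-- Induction on the degree: the normal derivative is harmonic with vanishing Cauchy data again,
hence zero, so that the polynomial is constant along the normal. -/
lemma eq_zero_of_lap_eq_zero_of_cauchy {n : Pt d} (hn : ‖n‖ = 1) (hlap : lap p = 0)
    (hp : ∀ w ∈ (ℝ ∙ n)ᗮ, evalAt p (x₀ + w) = 0)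
    (hDp : ∀ w ∈ (ℝ ∙ n)ᗮ, evalAt (dirDerivation n p) (x₀ + w) = 0) : p = 0 := by
  obtain ⟨m, hm⟩ : ∃ m : ℕ, p ∈ polySpace d ((m : ℤ) - 1) :=
    (exists_mem_polySpace p).imp' (· + 1) fun m hm => by simpa using hm
  induction m generalizing p with
  | zero => exact eq_zero_of_mem_polySpace_of_neg (by norm_num) hm
  | succ m ih =>
    refine eq_zero_of_dirDerivation_eq_zero hn (ih ?_ hDp ?_ ?_) hp
    · rw [lap_dirDerivation, hlap, map_zero]
    · exact evalAt_normal_normal_eq_zero hn hlap hp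
    · simpa using dirDerivation_mem_polySpace hm n

end Cauchy

/-! ### Surface measure on hyperplanes -/

section Hyperplanes

variable {E : Type*} [NormedAddCommGroup E] [InnerProductSpace ℝ E]

/-- The direction of the hyperplanes orthogonal to `n`. -/
abbrev perp (n : E) : Submodule ℝ E := (ℝ ∙ n)ᗮ

/-- The hyperplane through `x₀` orthogonal to `n`, parametrised by its direction. -/
def hyperplaneMap (n x₀ : E) : perp n →ᵃ[ℝ] E :=
  (perp n).subtype.toAffineMap + AffineMap.const ℝ _ x₀

lemma hyperplaneMap_apply (n x₀ : E) (w : perp n) : hyperplaneMap n x₀ w = x₀ + w := by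
  simp [hyperplaneMap, add_comm]

lemma isometry_hyperplaneMap (n x₀ : E) : Isometry (hyperplaneMap n x₀) :=
  Isometry.of_dist_eq fun a b => by simp [hyperplaneMap_apply, Subtype.dist_eq]

lemma mem_range_hyperplaneMap {n x₀ x : E} :
    x ∈ Set.range (hyperplaneMap n x₀) ↔ inner ℝ n (x - x₀) = 0 := by
  rw [← Submodule.mem_orthogonal_singleton_iff_inner_right]
  constructor
  · rintro ⟨w, rfl⟩
    simp [hyperplaneMap_apply]
  · intro h
    exact ⟨⟨x - x₀, h⟩, by simp [hyperplaneMap_apply]⟩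

/-- Coordinates along the hyperplane through `x₀` orthogonal to `n` and a transversal direction
`v`. -/
def slantedMap (n x₀ v : E) (p : ℝ × perp n) : E := hyperplaneMap n x₀ p.2 + p.1 • v

lemma slantedMap_injective {n : E} (x₀ : E) {v : E} (hv : inner ℝ n v ≠ 0) :
    Function.Injective (slantedMap n x₀ v) := by
  rintro ⟨t, w⟩ ⟨t', w'⟩ h
  have horth (w : perp n) : inner ℝ n (w : E) = 0 :=
    Submodule.mem_orthogonal_singleton_iff_inner_right.1 w.2
  simp only [slantedMap, hyperplaneMap_apply] at h
  have hinner := congrArg (inner ℝ n) h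
  simp only [inner_add_right, inner_smul_right, horth, add_zero, add_right_inj] at hinner
  obtain rfl : t = t' := mul_right_cancel₀ hv hinner
  simp only [add_left_inj, add_right_inj] at h
  rw [Subtype.ext h]

variable [FiniteDimensional ℝ E]

lemma finrank_perp {n : E} (hn : n ≠ 0) : Module.finrank ℝ (perp n) = Module.finrank ℝ E - 1 := by
  have h := (ℝ ∙ n).finrank_add_finrank_orthogonal
  rw [finrank_span_singleton hn] at h
  exact Nat.eq_sub_of_add_eq' h

variable [MeasurableSpace E] [BorelSpace E]

lemma measurableEmbedding_hyperplaneMap (n x₀ : E) : MeasurableEmbedding (hyperplaneMap n x₀) :=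
  (isometry_hyperplaneMap n x₀).isClosedEmbedding.measurableEmbedding

lemma map_hyperplaneMap {n : E} (hn : n ≠ 0) (x₀ : E) :
    (volume : Measure (perp n)).map (hyperplaneMap n x₀) =
      (μHE[Module.finrank ℝ E - 1] : Measure E).restrict (Set.range (hyperplaneMap n x₀)) := by
  rw [← (isometry_hyperplaneMap n x₀).map_euclideanHausdorffMeasure, ← finrank_perp hn,
    InnerProductSpace.euclideanHausdorffMeasure_eq_volume]

lemma volume_preimage_hyperplaneMap {n : E} (hn : n ≠ 0) (x₀ : E) (A : Set E) :
    volume (hyperplaneMap n x₀ ⁻¹' A) =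
      (μHE[Module.finrank ℝ E - 1] : Measure E) (A ∩ Set.range (hyperplaneMap n x₀)) := by
  rw [← (measurableEmbedding_hyperplaneMap n x₀).map_apply, map_hyperplaneMap hn,
    Measure.restrict_apply' (measurableEmbedding_hyperplaneMap n x₀).measurableSet_range]

lemma setIntegral_hyperplaneMap {F : Type*} [NormedAddCommGroup F] [NormedSpace ℝ F] {n : E}
    (hn : n ≠ 0) (x₀ : E) {A : Set E} (hA : MeasurableSet A)
    (hsub : A ⊆ Set.range (hyperplaneMap n x₀)) (f : E → F) :
    ∫ w in hyperplaneMap n x₀ ⁻¹' A, f (hyperplaneMap n x₀ w) =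
      ∫ x in A, f x ∂(μHE[Module.finrank ℝ E - 1] : Measure E) := by
  rw [← (measurableEmbedding_hyperplaneMap n x₀).setIntegral_map, map_hyperplaneMap hn,
    Measure.restrict_restrict hA, Set.inter_eq_left.2 hsub]

lemma measurePreserving_orthogonal {n : E} (hn : ‖n‖ = 1) (x₀ : E) :
    MeasurePreserving (slantedMap n x₀ n) (volume.prod volume) volume := by
  have hdecomp := ((ℝ ∙ n).measurePreserving_measurableEquivProd x₀).symm
  rw [InnerProductSpace.euclideanHausdorffMeasure_eq_volume] at hdecomp
  have hline := (LinearIsometryEquiv.toSpanUnitSingleton (𝕜 := ℝ) n hn).measurePreserving.prod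
    (MeasurePreserving.id (volume : Measure (perp n)))
  have hcomp : slantedMap n x₀ n = ((ℝ ∙ n).measurableEquivProd x₀).symm ∘
      Prod.map (LinearIsometryEquiv.toSpanUnitSingleton (𝕜 := ℝ) n hn) id := by
    funext p
    simp only [slantedMap, hyperplaneMap_apply, Function.comp, Prod.map, id, vadd_eq_add,
      Submodule.measurableEquivProd_symm_apply, LinearIsometryEquiv.toSpanUnitSingleton_apply]
    abel
  rw [hcomp]
  exact hdecomp.comp hline

/-- The slanted coordinates are the orthogonal ones composed with a shear. -/
lemma measurePreserving_slantedMap {n : E} (hn : ‖n‖ = 1) (x₀ : E) {v : E}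
    (hv : inner ℝ n v ≠ 0) :
    MeasurePreserving (slantedMap n x₀ v)
      ((ENNReal.ofReal |inner ℝ n v| • volume).prod volume) volume := by
  set c := inner ℝ n v with hc
  have htangential : v - c • n ∈ perp n := by
    rw [Submodule.mem_orthogonal_singleton_iff_inner_right, inner_sub_right, inner_smul_right,
      real_inner_self_eq_norm_sq, hn, ← hc]
    ring
  have hscale : MeasurePreserving (fun t : ℝ => c * t) (ENNReal.ofReal |c| • volume) volume := by
    refine ⟨by fun_prop, ?_⟩
    rw [Measure.map_smul, Real.smul_map_volume_mul_left hv]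
  have hshear : MeasurePreserving
      (fun p : ℝ × perp n => (c * p.1, p.1 • (⟨_, htangential⟩ : perp n) + p.2))
      ((ENNReal.ofReal |c| • volume).prod volume) (volume.prod volume) :=
    hscale.skew_product (g := fun t w => t • (⟨_, htangential⟩ : perp n) + w) (by fun_prop)
      (Filter.Eventually.of_forall fun t => map_add_left_eq_self volume _)
  convert (measurePreserving_orthogonal hn x₀).comp hshear using 1
  funext p
  simp only [slantedMap, Function.comp, hyperplaneMap_apply, Submodule.coe_add,
    Submodule.coe_smul, smul_sub, smul_smul, mul_comm c]
  abel

lemma measurableEmbedding_slantedMap {n : E} (x₀ : E) {v : E} (hv : inner ℝ n v ≠ 0) :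
    MeasurableEmbedding (slantedMap n x₀ v) := by
  have hcont : Continuous (slantedMap n x₀ v) := by
    have := (isometry_hyperplaneMap n x₀).continuous
    unfold slantedMap
    fun_prop
  exact hcont.measurableEmbedding (slantedMap_injective x₀ hv)

lemma ae_line_notMem_of_measure_eq_zero {n : E} (hn : ‖n‖ = 1) {x₀ v : E} (hv : inner ℝ n v ≠ 0)
    {A : Set E} (hA : A ⊆ Set.range (hyperplaneMap n x₀))
    (hA0 : (μHE[Module.finrank ℝ E - 1] : Measure E) A = 0) :
    ∀ᵐ x : E, ∀ t : ℝ, x + t • v ∉ A := by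
  rw [ae_iff, ← (measurePreserving_slantedMap hn x₀ hv).measure_preimage_emb
    (measurableEmbedding_slantedMap x₀ hv)]
  refine measure_mono_null (t := Set.univ ×ˢ (hyperplaneMap n x₀ ⁻¹' A)) ?_ ?_
  · rintro ⟨s, w⟩ h
    simp only [not_forall, not_not, Set.mem_preimage, Set.mem_ofPred_eq] at h
    obtain ⟨t, ht⟩ := h
    obtain ⟨w', hw'⟩ := hA ht
    obtain ⟨-, rfl⟩ := Prod.mk.inj <| @slantedMap_injective E _ _ n x₀ v hv (s + t, w) (0, w')
      (by simp only [slantedMap] at hw' ⊢; rw [hw']; module)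
    exact ⟨trivial, by rwa [Set.mem_preimage, hw']⟩
  · have hn0 : n ≠ 0 := norm_ne_zero_iff.1 (hn ▸ one_ne_zero)
    rw [Measure.prod_prod, volume_preimage_hyperplaneMap hn0,
      measure_mono_null Set.inter_subset_left hA0, mul_zero]

lemma volume_range_hyperplaneMap {n : E} (hn : n ≠ 0) (x₀ : E) :
    volume (Set.range (hyperplaneMap n x₀)) = 0 := by
  have hne : (⊤ : AffineSubspace ℝ (perp n)).map (hyperplaneMap n x₀) ≠ ⊤ := by
    intro htop
    have hmem : x₀ + n ∈ (⊤ : AffineSubspace ℝ (perp n)).map (hyperplaneMap n x₀) := by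
      rw [htop]; trivial
    obtain ⟨w, -, hw⟩ := hmem
    have := mem_range_hyperplaneMap.1 ⟨w, hw⟩
    simp [hn] at this
  simpa using Measure.addHaar_affineSubspace volume _ hne

lemma ae_line_notMem_hyperplane {n : E} (hn : n ≠ 0) (x₀ : E) {v : E} (hv : inner ℝ n v = 0) :
    ∀ᵐ x : E, ∀ t : ℝ, x + t • v ∉ Set.range (hyperplaneMap n x₀) := by
  filter_upwards [compl_mem_ae_iff.2 (volume_range_hyperplaneMap hn x₀)] with x hx t ht
  rw [mem_range_hyperplaneMap, add_sub_right_comm, inner_add_right, inner_smul_right, hv, mul_zero,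
    add_zero] at ht
  exact hx (mem_range_hyperplaneMap.2 ht)

end Hyperplanes

/-! ### Polyhedral sets -/

section Polyhedral

lemma preimage_convexHull_subset_closure_interior {V E : Type*} [NormedAddCommGroup V]
    [NormedSpace ℝ V] [FiniteDimensional ℝ V] [AddCommGroup E] [Module ℝ E] {ι : Type*} [Fintype ι]
    {p : ι → E} (hp : AffineIndependent ℝ p) {L : V →ᵃ[ℝ] E} (hL : Function.Injective L)
    (hcard : Fintype.card ι = Module.finrank ℝ V + 1)
    (hsub : convexHull ℝ (Set.range p) ⊆ Set.range L) :
    L ⁻¹' convexHull ℝ (Set.range p) ⊆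
      closure (interior (L ⁻¹' convexHull ℝ (Set.range p))) := by
  choose q hq using fun i => hsub (subset_convexHull ℝ _ (Set.mem_range_self i))
  obtain rfl : L ∘ q = p := funext hq
  have hpre : L ⁻¹' convexHull ℝ (Set.range (L ∘ q)) = convexHull ℝ (Set.range q) := by
    rw [Set.range_comp, ← AffineMap.image_convexHull, Set.preimage_image_eq _ hL]
  have hspan : affineSpan ℝ (Set.range q) = ⊤ :=
    (hp.of_comp L).affineSpan_eq_top_iff_card_eq_finrank_add_one.2 hcard
  rw [hpre, (convex_convexHull ℝ (Set.range q)).closure_interior_eq_closure_of_nonempty_interior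
    (interior_convexHull_nonempty_iff_affineSpan_eq_top.2 hspan)]
  exact subset_closure

namespace IsPolyhedral

variable {d m : ℕ} {S : Set (Pt d)}

lemma isCompact (h : IsPolyhedral m S) : IsCompact S := by
  obtain ⟨𝒮, hfin, -, rfl⟩ := h
  exact hfin.isCompact_biUnion fun s _ => (Set.finite_range _).isCompact_convexHull ℝ

lemma nonempty (h : IsPolyhedral m S) : S.Nonempty := by
  obtain ⟨𝒮, -, ⟨s, hs⟩, rfl⟩ := h
  exact ⟨s.points 0, Set.mem_biUnion hs (subset_convexHull ℝ _ ⟨0, rfl⟩)⟩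

lemma preimage_subset_closure_interior {V : Type*} [NormedAddCommGroup V] [NormedSpace ℝ V]
    [FiniteDimensional ℝ V] (h : IsPolyhedral m S) {L : V →ᵃ[ℝ] Pt d} (hL : Function.Injective L)
    (hm : Module.finrank ℝ V = m) (hS : S ⊆ Set.range L) :
    L ⁻¹' S ⊆ closure (interior (L ⁻¹' S)) := by
  obtain ⟨𝒮, -, -, rfl⟩ := h
  rw [Set.preimage_iUnion₂]
  refine Set.iUnion₂_subset fun s hs => ?_
  have hsub := Set.subset_biUnion_of_mem (u := fun s : Affine.Simplex ℝ (Pt d) m =>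
    convexHull ℝ (Set.range s.points)) hs
  exact (preimage_convexHull_subset_closure_interior s.independent hL (by simp [hm])
    (hsub.trans hS)).trans (closure_mono (interior_mono (Set.subset_biUnion_of_mem
      (u := fun s : Affine.Simplex ℝ (Pt d) m => L ⁻¹' convexHull ℝ (Set.range s.points)) hs)))

lemma subset_closure_interior (h : IsPolyhedral d S) : S ⊆ closure (interior S) := by
  simpa using h.preimage_subset_closure_interior (L := AffineMap.id ℝ (Pt d))
    Function.injective_id (by simp) (by simp)

end IsPolyhedral

end Polyhedral

lemma subset_interior_of_isPreconnected {X : Type*} [TopologicalSpace X] {s t : Set X}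
    (hs : IsPreconnected s) (hdisj : Disjoint s (frontier t)) (hst : (s ∩ t).Nonempty) :
    s ⊆ interior t := by
  have hsplit : s ⊆ interior t ∪ (closure t)ᶜ := fun x hx => by
    by_contra! hc
    exact hdisj.notMem_of_mem_left hx ⟨not_not.1 fun hcl => hc (Or.inr hcl),
      fun hint => hc (Or.inl hint)⟩
  obtain ⟨a, has, hat⟩ := hst
  exact hs.subset_left_of_subset_union isOpen_interior isClosed_closure.isOpen_compl
    (disjoint_compl_right.mono_left interior_subset_closure) hsplit
    ⟨a, has, (hsplit has).resolve_right fun h => h (subset_closure hat)⟩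

lemma disjoint_of_isPreconnected {X : Type*} [TopologicalSpace X] {s t : Set X}
    (hs : IsPreconnected s) (hdisj : Disjoint s (frontier t)) (hst : (s ∩ tᶜ).Nonempty) :
    Disjoint s t := by
  obtain ⟨b, hbs, hbt⟩ := hst
  refine Set.disjoint_left.2 fun a has hat => hbt (interior_subset ?_)
  exact subset_interior_of_isPreconnected hs hdisj ⟨a, has, hat⟩ hbs

/-! ### Geometry of the mesh -/

namespace PolytopalMesh

variable {d : ℕ} {Ω : Set (Pt d)} (M : PolytopalMesh Ω) {T e : Set (Pt d)}

lemma exists_elem_of_face (he : e ∈ M.faces) : ∃ T ∈ M.elems, e ⊆ frontier T := by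
  have hcard : {T | T ∈ M.elems ∧ e ⊆ frontier T}.ncard ≠ 0 := by
    by_cases hb : e ⊆ frontier Ω
    · rw [M.boundary_face e he hb]; norm_num
    · rw [M.interior_face e he hb]; norm_num
  obtain ⟨T, hT⟩ := Set.nonempty_of_ncard_ne_zero hcard
  exact ⟨T, hT⟩

lemma isCompact_face (he : e ∈ M.faces) : IsCompact e := (M.face_polyhedral e he).isCompact

lemma isCompact_elem (hT : T ∈ M.elems) : IsCompact T := (M.elem_polyhedral T hT).isCompact

lemma isClosed_elem (hT : T ∈ M.elems) : IsClosed T := (M.isCompact_elem hT).isClosed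

lemma norm_normal (hT : T ∈ M.elems) (he : e ∈ M.faces) (heT : e ⊆ frontier T) :
    ‖M.normal T e‖ = 1 :=
  (M.isOutwardUnitNormal T hT e he heT).norm_eq_one

lemma normal_ne_zero (hT : T ∈ M.elems) (he : e ∈ M.faces) (heT : e ⊆ frontier T) :
    M.normal T e ≠ 0 :=
  norm_ne_zero_iff.1 (M.norm_normal hT he heT ▸ one_ne_zero)

lemma face_subset_hyperplane (hT : T ∈ M.elems) (he : e ∈ M.faces) (heT : e ⊆ frontier T)
    {x₀ : Pt d} (hx₀ : x₀ ∈ e) : e ⊆ Set.range (hyperplaneMap (M.normal T e) x₀) := fun x hx =>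
  mem_range_hyperplaneMap.2 ((M.isOutwardUnitNormal T hT e he heT).orthogonal x hx x₀ hx₀)

lemma measure_face_inter (he : e ∈ M.faces) (hT : T ∈ M.elems) (heT : e ⊆ frontier T)
    {x₀ : Pt d} (hx₀ : x₀ ∈ e) (U : Set (Pt d)) :
    (μHE[d - 1] : Measure (Pt d)) (e ∩ U) =
      volume (hyperplaneMap (M.normal T e) x₀ ⁻¹' (e ∩ U)) := by
  rw [volume_preimage_hyperplaneMap (M.normal_ne_zero hT he heT), finrank_euclideanSpace_fin,
    Set.inter_eq_left.2 (Set.inter_subset_left.trans (M.face_subset_hyperplane hT he heT hx₀))]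

lemma measure_face_lt_top (he : e ∈ M.faces) : (μHE[d - 1] : Measure (Pt d)) e < ⊤ := by
  obtain ⟨T, hT, heT⟩ := M.exists_elem_of_face he
  obtain ⟨x₀, hx₀⟩ := (M.face_polyhedral e he).nonempty
  rw [← Set.inter_univ e, M.measure_face_inter he hT heT hx₀, Set.inter_univ]
  exact ((isometry_hyperplaneMap _ x₀).isClosedEmbedding.isCompact_preimage
    (M.isCompact_face he)).measure_lt_top

lemma measure_face_inter_pos (he : e ∈ M.faces) {U : Set (Pt d)} (hU : IsOpen U)
    (h : (e ∩ U).Nonempty) : 0 < (μHE[d - 1] : Measure (Pt d)) (e ∩ U) := by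
  obtain ⟨T, hT, heT⟩ := M.exists_elem_of_face he
  obtain ⟨x₀, hx₀, hxU⟩ := h
  have hiso := isometry_hyperplaneMap (M.normal T e) x₀
  have hx₀L : hyperplaneMap (M.normal T e) x₀ 0 = x₀ := by simp [hyperplaneMap_apply]
  have hclosure : (0 : perp (M.normal T e)) ∈
      closure (interior (hyperplaneMap (M.normal T e) x₀ ⁻¹' e)) :=
    (M.face_polyhedral e he).preimage_subset_closure_interior hiso.injective
      (by rw [finrank_perp (M.normal_ne_zero hT he heT), finrank_euclideanSpace_fin])
      (M.face_subset_hyperplane hT he heT hx₀) (by rwa [Set.mem_preimage, hx₀L])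
  have hUpre : IsOpen (hyperplaneMap (M.normal T e) x₀ ⁻¹' U) := hU.preimage hiso.continuous
  rw [M.measure_face_inter he hT heT hx₀, Set.preimage_inter, Set.inter_comm]
  exact ((hUpre.inter isOpen_interior).measure_pos _ (mem_closure_iff.1 hclosure _ hUpre
    (by rwa [Set.mem_preimage, hx₀L]))).trans_le
      (measure_mono (Set.inter_subset_inter_right _ interior_subset))

lemma faceMeasure_apply (he : e ∈ M.faces) (s : Set e) :
    faceMeasure e s = (μHE[d - 1] : Measure (Pt d)) (Subtype.val '' s) :=
  comap_subtype_coe_apply (M.isCompact_face he).measurableSet _ s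

instance isFiniteMeasure_faceMeasure (e : M.faces) : IsFiniteMeasure (faceMeasure e.1) where
  measure_univ_lt_top := by
    rw [M.faceMeasure_apply e.2]
    simpa using M.measure_face_lt_top e.2

instance isOpenPosMeasure_faceMeasure (e : M.faces) : (faceMeasure e.1).IsOpenPosMeasure where
  open_pos s hs hne := by
    obtain ⟨U, hU, rfl⟩ := isOpen_induced_iff.1 hs
    rw [M.faceMeasure_apply e.2, Subtype.image_preimage_coe]
    exact (M.measure_face_inter_pos e.2 hU (Subtype.preimage_coe_nonempty.1 hne)).ne'

instance compactSpace_face (e : M.faces) : CompactSpace e.1 :=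
  isCompact_iff_compactSpace.1 (M.isCompact_face e.2)

lemma integral_faceMeasure (he : e ∈ M.faces) (f : Pt d → ℝ) :
    ∫ x, f x ∂(faceMeasure e) = ∫ x in e, f x ∂(μHE[d - 1] : Measure (Pt d)) :=
  integral_subtype_comap (M.isCompact_face he).measurableSet f

lemma volume_face (he : e ∈ M.faces) : volume e = 0 := by
  obtain ⟨T, hT, heT⟩ := M.exists_elem_of_face he
  obtain ⟨x₀, hx₀⟩ := (M.face_polyhedral e he).nonempty
  exact measure_mono_null (M.face_subset_hyperplane hT he heT hx₀)
    (volume_range_hyperplaneMap (M.normal_ne_zero hT he heT) x₀)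

lemma exists_face_of_mem_frontier (hT : T ∈ M.elems) {x : Pt d} (hx : x ∈ frontier T) :
    ∃ e ∈ M.faces, e ⊆ frontier T ∧ x ∈ e := by
  rw [M.frontier_elem T hT, Set.mem_iUnion₂] at hx
  obtain ⟨e, ⟨he, heT⟩, hxe⟩ := hx
  exact ⟨e, he, heT, hxe⟩

lemma exists_face_of_mem_frontier_domain {x : Pt d} (hx : x ∈ frontier Ω) :
    ∃ e ∈ M.faces, e ⊆ frontier Ω ∧ x ∈ e := by
  rw [M.frontier_domain, Set.mem_iUnion₂] at hx
  obtain ⟨e, ⟨he, heΩ⟩, hxe⟩ := hx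
  exact ⟨e, he, heΩ, hxe⟩

lemma volume_iUnion_faces : volume (⋃ e ∈ M.faces, e) = 0 :=
  (measure_biUnion_null_iff M.faces.countable_toSet).2 fun _ he => M.volume_face he

lemma volume_frontier_elem (hT : T ∈ M.elems) : volume (frontier T) = 0 := by
  refine measure_mono_null (fun x hx => ?_) M.volume_iUnion_faces
  obtain ⟨e, he, -, hxe⟩ := M.exists_face_of_mem_frontier hT hx
  exact Set.mem_biUnion he hxe

include M in
lemma volume_frontier_domain : volume (frontier Ω) = 0 := by
  refine measure_mono_null (fun x hx => ?_) M.volume_iUnion_faces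
  obtain ⟨e, he, -, hxe⟩ := M.exists_face_of_mem_frontier_domain hx
  exact Set.mem_biUnion he hxe

/-! ### Regular boundary points -/

/-- A boundary point of `T` at which `T` looks like a half-space: `p` lies on no face other than
`e`, and `T` lies on the side of `-n` of `e` at `p`. -/
structure IsRegularAt (T e : Set (Pt d)) (p : Pt d) : Prop where
  eq_of_mem : ∀ e' ∈ M.faces, p ∈ e' → e' = e
  outward : ∀ᶠ t in 𝓝[>] (0 : ℝ),
    p - t • M.normal T e ∈ interior T ∧ p + t • M.normal T e ∉ T

lemma ae_line_isRegularAt_of_inner_ne_zero (hT : T ∈ M.elems) (he : e ∈ M.faces)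
    (heT : e ⊆ frontier T) {v : Pt d} (hv : inner ℝ (M.normal T e) v ≠ 0) :
    ∀ᵐ x : Pt d, ∀ t : ℝ, x + t • v ∈ e → M.IsRegularAt T e (x + t • v) := by
  obtain ⟨x₀, hx₀⟩ := (M.face_polyhedral e he).nonempty
  have hN := M.isOutwardUnitNormal T hT e he heT
  have havoid {A : Set (Pt d)} (hA : A ⊆ e) (hA0 : (μHE[d - 1] : Measure (Pt d)) A = 0) :
      ∀ᵐ x : Pt d, ∀ t : ℝ, x + t • v ∉ A :=
    ae_line_notMem_of_measure_eq_zero hN.norm_eq_one hv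
      (hA.trans (M.face_subset_hyperplane hT he heT hx₀))
      (by rwa [finrank_euclideanSpace_fin])
  have hsingle : ∀ᵐ x : Pt d, ∀ e' ∈ M.faces, e' ≠ e → ∀ t : ℝ, x + t • v ∉ e ∩ e' := by
    refine (ae_ball_iff M.faces.countable_toSet).2 fun e' he' => ?_
    rw [Filter.eventually_imp_distrib_left]
    exact fun hne => havoid Set.inter_subset_left (M.face_disjoint e he e' he' hne.symm)
  have hnull := hN.outward
  rw [ae_restrict_iff' (M.isCompact_face he).measurableSet, ae_iff] at hnull
  have houtward := havoid (fun x hx => by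
    simp only [Set.mem_ofPred_eq, Classical.not_imp] at hx
    exact hx.1) hnull
  filter_upwards [hsingle, houtward] with x hxsingle hxout t ht
  exact ⟨fun e' he' hmem => by_contra fun hne => hxsingle e' he' hne t ⟨ht, hmem⟩,
    not_not.1 (hxout t) ht⟩

lemma ae_line_transversal (v : Pt d) :
    ∀ᵐ x : Pt d, ∀ T ∈ M.elems, ∀ e ∈ M.faces, e ⊆ frontier T → ∀ t : ℝ, x + t • v ∈ e →
      inner ℝ (M.normal T e) v ≠ 0 ∧ M.IsRegularAt T e (x + t • v) := by
  refine (ae_ball_iff M.elems.countable_toSet).2 fun T hT =>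
    (ae_ball_iff M.faces.countable_toSet).2 fun e he =>
      Filter.eventually_imp_distrib_left.2 fun heT => ?_
  by_cases hv : inner ℝ (M.normal T e) v = 0
  · obtain ⟨x₀, hx₀⟩ := (M.face_polyhedral e he).nonempty
    filter_upwards [ae_line_notMem_hyperplane (M.normal_ne_zero hT he heT) x₀ hv] with x hx t ht
    exact absurd (M.face_subset_hyperplane hT he heT hx₀ ht) (hx t)
  · filter_upwards [M.ae_line_isRegularAt_of_inner_ne_zero hT he heT hv] with x hx t ht
    exact ⟨hv, hx t ht⟩

namespace IsRegularAt

variable {M} {p : Pt d}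

lemma eventually_mem_frontier (hreg : M.IsRegularAt T e p) (hT : T ∈ M.elems) (he : e ∈ M.faces)
    (heT : e ⊆ frontier T) (hp : p ∈ e) :
    ∀ᶠ y in 𝓝 p, y ∈ frontier T → inner ℝ (M.normal T e) (y - p) = 0 := by
  have hothers : ∀ᶠ y in 𝓝 p, ∀ e' ∈ M.faces, y ∈ e' → e' = e :=
    (Filter.eventually_all_finset M.faces).2 fun e' he' => by
      by_cases hee : e' = e
      · exact Filter.Eventually.of_forall fun _ _ => hee
      · filter_upwards [(M.isCompact_face he').isClosed.isOpen_compl.mem_nhds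
          fun hp' => hee (hreg.eq_of_mem e' he' hp')] with y hy hye'
        exact absurd hye' hy
  filter_upwards [hothers] with y hy hyT
  obtain ⟨e', he', -, hye'⟩ := M.exists_face_of_mem_frontier hT hyT
  obtain rfl := hy e' he' hye'
  exact (M.isOutwardUnitNormal T hT e' he heT).orthogonal y hye' p hp

lemma eventually_mem_interior_and_notMem (hreg : M.IsRegularAt T e p) (hT : T ∈ M.elems)
    (he : e ∈ M.faces) (heT : e ⊆ frontier T) (hp : p ∈ e) :
    ∀ᶠ y in 𝓝 p, (inner ℝ (M.normal T e) (y - p) < 0 → y ∈ interior T) ∧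
      (0 < inner ℝ (M.normal T e) (y - p) → y ∉ T) := by
  set n := M.normal T e
  have hn1 : ‖n‖ = 1 := M.norm_normal hT he heT
  obtain ⟨r, hr, hball⟩ := Metric.eventually_nhds_iff_ball.1
    (hreg.eventually_mem_frontier hT he heT hp)
  obtain ⟨s, ⟨hin, hout⟩, hs⟩ := (hreg.outward.and (Ioo_mem_nhdsGT hr)).exists
  have hsn : ‖s • n‖ < r := by
    rw [norm_smul, hn1, mul_one, Real.norm_of_nonneg hs.1.le]
    exact hs.2
  have hbelow : Metric.ball p r ∩ {y | inner ℝ n y < inner ℝ n p} ⊆ interior T := by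
    refine subset_interior_of_isPreconnected ((convex_ball p r).inter
      (convex_halfSpace_lt (innerSL ℝ n).isLinear _)).isPreconnected ?_
      ⟨p - s • n, ⟨by simpa [dist_eq_norm] using hsn, ?_⟩, interior_subset hin⟩
    · refine Set.disjoint_left.2 fun y ⟨hy, hlt⟩ hyT => ne_of_lt (α := ℝ) hlt ?_
      rw [← sub_eq_zero, ← inner_sub_right, hball y hy hyT]
    · simpa [inner_sub_right, inner_smul_right, hn1] using hs.1
  have habove : Disjoint (Metric.ball p r ∩ {y | inner ℝ n p < inner ℝ n y}) T := by
    refine disjoint_of_isPreconnected ((convex_ball p r).inter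
      (convex_halfSpace_gt (innerSL ℝ n).isLinear _)).isPreconnected ?_
      ⟨p + s • n, ⟨by simpa [dist_eq_norm] using hsn, ?_⟩, hout⟩
    · refine Set.disjoint_left.2 fun y ⟨hy, hlt⟩ hyT => ne_of_gt (α := ℝ) hlt ?_
      rw [← sub_eq_zero, ← inner_sub_right, hball y hy hyT]
    · simpa [inner_add_right, inner_smul_right, hn1] using hs.1
  filter_upwards [Metric.ball_mem_nhds p hr] with y hy
  rw [inner_sub_right, sub_neg, sub_pos]
  exact ⟨fun hlt => hbelow ⟨hy, hlt⟩, fun hlt => habove.notMem_of_mem_left ⟨hy, hlt⟩⟩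

end IsRegularAt

end PolytopalMesh

/-! ### The divergence theorem on an element -/

lemma exists_forall_eventually_eq {X Y : Type*} [TopologicalSpace X] [T1Space X]
    [PreconnectedSpace X] [Nonempty X] [∀ x : X, (𝓝[≠] x).NeBot] {φ : X → Y}
    (h : ∀ x, ∃ c, ∀ᶠ y in 𝓝[≠] x, φ y = c) : ∃ c, ∀ x, ∀ᶠ y in 𝓝[≠] x, φ y = c := by
  choose c hc using h
  have hloc : IsLocallyConstant c := by
    refine (IsLocallyConstant.iff_eventually_eq c).2 fun x => ?_
    have hnear : ∀ᶠ y in 𝓝[≠] x, ∀ᶠ z in 𝓝 y, φ z = c x := by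
      filter_upwards [eventually_eventually_nhdsWithin.2 (hc x), self_mem_nhdsWithin] with y hy hyx
      rwa [isOpen_compl_singleton.nhdsWithin_eq hyx] at hy
    filter_upwards [eventually_nhdsWithin_iff.1 hnear] with y hy
    obtain rfl | hyx := eq_or_ne y x
    · rfl
    · obtain ⟨z, hzx, hzy⟩ := (((hy hyx).filter_mono nhdsWithin_le_nhds).and (hc y)).exists
      rw [← hzx, hzy]
  obtain ⟨x₀⟩ := ‹Nonempty X›
  exact ⟨c x₀, fun x => hloc.apply_eq_of_preconnectedSpace x x₀ ▸ hc x⟩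

section Shadow

variable {E : Type*} [NormedAddCommGroup E] {e : Set E} {x v : E} {s s₀ : ℝ}

/-- The points from which `e` is visible in the direction `v`. -/
def shadow [NormedSpace ℝ E] (e : Set E) (v : E) : Set E := {x | ∃ t : ℝ, 0 < t ∧ x + t • v ∈ e}

section NormedSpace

variable [NormedSpace ℝ E]

lemma add_smul_mem_shadow : x + s • v ∈ shadow e v ↔ ∃ u : ℝ, s < u ∧ x + u • v ∈ e := by
  constructor
  · rintro ⟨t, ht, hmem⟩
    exact ⟨s + t, lt_add_of_pos_right s ht, by rwa [add_assoc, ← add_smul] at hmem⟩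
  · rintro ⟨u, hu, hmem⟩
    exact ⟨u - s, sub_pos.2 hu, by rwa [add_assoc, ← add_smul, add_sub_cancel]⟩

lemma eventually_indicator_shadow_eq (he : IsClosed e) (h : x + s₀ • v ∉ e) :
    ∀ᶠ s in 𝓝 s₀, (shadow e v).indicator (1 : E → ℝ) (x + s • v) =
      (shadow e v).indicator 1 (x + s₀ • v) := by
  have hcont : Continuous fun s : ℝ => x + s • v := by fun_prop
  obtain ⟨r, hr, hball⟩ := Metric.isOpen_iff.1 (he.isOpen_compl.preimage hcont) s₀ h
  have htransfer {a b : ℝ} (ha : a ∈ Metric.ball s₀ r) (hb : b ∈ Metric.ball s₀ r) :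
      x + a • v ∈ shadow e v → x + b • v ∈ shadow e v := by
    simp only [add_smul_mem_shadow]
    rintro ⟨u, hu, hmem⟩
    refine ⟨u, lt_of_not_ge fun hub => hball ?_ hmem, hmem⟩
    rw [Real.ball_eq_Ioo] at ha hb ⊢
    exact ⟨ha.1.trans hu, hub.trans_lt hb.2⟩
  filter_upwards [Metric.ball_mem_nhds s₀ hr] with s hs
  have hiff : x + s • v ∈ shadow e v ↔ x + s₀ • v ∈ shadow e v :=
    ⟨htransfer hs (Metric.mem_ball_self hr), htransfer (Metric.mem_ball_self hr) hs⟩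
  exact Set.indicator_const_eq_indicator_const hiff

lemma setIntegral_Iio_fderiv {f : E → ℝ} (hf : ContDiff ℝ 1 f) (hfc : HasCompactSupport f)
    (hv : v ≠ 0) (y : E) : ∫ t in Set.Iio (0 : ℝ), fderiv ℝ f (y + t • v) v = f y := by
  have hderiv (t : ℝ) :
      HasDerivAt (fun s : ℝ => f (y + s • v)) (fderiv ℝ f (y + t • v) v) t := by
    have hline : HasDerivAt (fun s : ℝ => y + s • v) v t := by
      simpa using ((hasDerivAt_id t).smul_const v).const_add y
    exact (hf.differentiable one_ne_zero (y + t • v)).hasFDerivAt.comp_hasDerivAt t hline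
  have hclosed : Topology.IsClosedEmbedding fun t : ℝ => y + t • v :=
    (Homeomorph.addLeft y).isClosedEmbedding.comp (isClosedEmbedding_smul_left hv)
  have hcontDiff : ContDiff ℝ 1 fun s : ℝ => f (y + s • v) := by fun_prop
  rw [← integral_Iic_eq_integral_Iio]
  simpa [funext fun t => (hderiv t).deriv] using
    HasCompactSupport.integral_Iic_deriv_eq hcontDiff (hfc.comp_isClosedEmbedding hclosed) 0

lemma integrable_fderiv_apply [MeasurableSpace E] [OpensMeasurableSpace E] {μ : Measure E}
    [IsFiniteMeasureOnCompacts μ] {f : E → ℝ} (hf : ContDiff ℝ 1 f) (hfc : HasCompactSupport f)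
    (v : E) : Integrable (fun x => fderiv ℝ f x v) μ :=
  ((hf.continuous_fderiv one_ne_zero).clm_apply continuous_const).integrable_of_hasCompactSupport
    (hfc.fderiv_apply (𝕜 := ℝ) v)

end NormedSpace

variable [InnerProductSpace ℝ E] {n : E}

lemma add_smul_notMem_shadow_of_lt (horth : ∀ x ∈ e, ∀ y ∈ e, inner ℝ n (x - y) = 0)
    (hv : inner ℝ n v ≠ 0) (h : x + s₀ • v ∈ e) (hs : s₀ < s) : x + s • v ∉ shadow e v := by
  rw [add_smul_mem_shadow]
  rintro ⟨u, hu, hmem⟩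
  have hzero := horth _ hmem _ h
  rw [add_sub_add_left_eq_sub, ← sub_smul, inner_smul_right] at hzero
  exact mul_ne_zero (sub_pos.2 (hs.trans hu)).ne' hv hzero

lemma shadow_eq_image_slantedMap {x₀ : E} (he : e ⊆ Set.range (hyperplaneMap n x₀)) :
    shadow e v = slantedMap n x₀ v '' (Set.Iio 0 ×ˢ (hyperplaneMap n x₀ ⁻¹' e)) := by
  ext x
  constructor
  · rintro ⟨t, ht, hmem⟩
    obtain ⟨w, hw⟩ := he hmem
    exact ⟨(-t, w), ⟨by simpa using ht, by simpa [hw] using hmem⟩, by simp [slantedMap, hw]⟩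
  · rintro ⟨⟨t, w⟩, ⟨ht, hw⟩, rfl⟩
    exact ⟨-t, by simpa using ht, by simpa [slantedMap] using hw⟩

variable [FiniteDimensional ℝ E] [MeasurableSpace E] [BorelSpace E]

lemma measurableSet_shadow (he : MeasurableSet e) {x₀ : E}
    (hsub : e ⊆ Set.range (hyperplaneMap n x₀)) (hv : inner ℝ n v ≠ 0) :
    MeasurableSet (shadow e v) := by
  rw [shadow_eq_image_slantedMap hsub]
  exact (measurableEmbedding_slantedMap x₀ hv).measurableSet_image' (measurableSet_Iio.prod
    ((measurableEmbedding_hyperplaneMap n x₀).measurable he))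

lemma setIntegral_shadow_fderiv (he : MeasurableSet e) {x₀ : E}
    (hsub : e ⊆ Set.range (hyperplaneMap n x₀)) (hn : ‖n‖ = 1) (hv : inner ℝ n v ≠ 0) {f : E → ℝ}
    (hf : ContDiff ℝ 1 f) (hfc : HasCompactSupport f) :
    ∫ x in shadow e v, fderiv ℝ f x v =
      |inner ℝ n v| * ∫ x in e, f x ∂(μHE[Module.finrank ℝ E - 1] : Measure E) := by
  have hn0 : n ≠ 0 := norm_ne_zero_iff.1 (hn ▸ one_ne_zero)
  have hv0 : v ≠ 0 := by
    rintro rfl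
    simp at hv
  have hmp := measurePreserving_slantedMap hn x₀ hv
  have hemb := measurableEmbedding_slantedMap x₀ hv
  have hpre : slantedMap n x₀ v ⁻¹' shadow e v = Set.Iio 0 ×ˢ (hyperplaneMap n x₀ ⁻¹' e) := by
    rw [shadow_eq_image_slantedMap hsub, Set.preimage_image_eq _ hemb.injective]
  have hint : Integrable (fun p => fderiv ℝ f (slantedMap n x₀ v p) v)
      ((ENNReal.ofReal |inner ℝ n v| • volume).prod volume) :=
    (hmp.integrable_comp_emb hemb).2 (integrable_fderiv_apply hf hfc v)
  have hline (w : perp n) : ∫ t in Set.Iio (0 : ℝ), fderiv ℝ f (hyperplaneMap n x₀ w + t • v) v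
      ∂(ENNReal.ofReal |inner ℝ n v| • volume) = |inner ℝ n v| * f (hyperplaneMap n x₀ w) := by
    rw [Measure.restrict_smul, integral_smul_measure, setIntegral_Iio_fderiv hf hfc hv0,
      ENNReal.toReal_ofReal (abs_nonneg _), smul_eq_mul]
  rw [← hmp.setIntegral_preimage_emb hemb, hpre, ← Measure.prod_restrict, integral_prod_symm _
    (by rw [Measure.prod_restrict]; exact hint.integrableOn)]
  simp only [slantedMap, hline]
  rw [integral_const_mul, setIntegral_hyperplaneMap hn0 x₀ he hsub]

end Shadow

namespace PolytopalMesh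

variable {d : ℕ} {Ω : Set (Pt d)} (M : PolytopalMesh Ω) {T : Set (Pt d)}

open Classical in
/-- The faces of the element `T`. -/
def facesOf (T : Set (Pt d)) : Finset (Set (Pt d)) := {e ∈ M.faces | e ⊆ frontier T}

lemma mem_facesOf {e : Set (Pt d)} : e ∈ M.facesOf T ↔ e ∈ M.faces ∧ e ⊆ frontier T := by
  simp [facesOf]

/-- The indicator of `T` minus the number of times the ray from `x` in the direction `v` leaves
`T`, net of the number of times it enters. -/
def crossingDefect (T : Set (Pt d)) (v x : Pt d) : ℝ :=
  T.indicator 1 x - ∑ e ∈ M.facesOf T,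
    SignType.sign (inner ℝ (M.normal T e) v) * (shadow e v).indicator (1 : Pt d → ℝ) x

variable {x v : Pt d} {s₀ : ℝ}

lemma eventually_crossingDefect_eq_of_notMem_frontier (hT : T ∈ M.elems)
    (h : x + s₀ • v ∉ frontier T) :
    ∀ᶠ s in 𝓝 s₀, M.crossingDefect T v (x + s • v) = M.crossingDefect T v (x + s₀ • v) := by
  have hcont : Continuous fun s : ℝ => x + s • v := by fun_prop
  have hindicator : ∀ᶠ s in 𝓝 s₀,
      T.indicator (1 : Pt d → ℝ) (x + s • v) = T.indicator 1 (x + s₀ • v) := by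
    by_cases hmem : x + s₀ • v ∈ T
    · filter_upwards [hcont.continuousAt.eventually (isOpen_interior.mem_nhds
        ((mem_interior_iff_notMem_frontier hmem).2 h))] with s hs
      simp [hmem, interior_subset hs]
    · filter_upwards [hcont.continuousAt.eventually
        ((M.isClosed_elem hT).isOpen_compl.mem_nhds hmem)] with s hs
      rw [Set.indicator_of_notMem hmem, Set.indicator_of_notMem hs]
  have hshadows : ∀ᶠ s in 𝓝 s₀, ∀ e ∈ M.facesOf T,
      (shadow e v).indicator (1 : Pt d → ℝ) (x + s • v) =
        (shadow e v).indicator 1 (x + s₀ • v) :=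
    (Filter.eventually_all_finset _).2 fun e he =>
      eventually_indicator_shadow_eq (M.isCompact_face (M.mem_facesOf.1 he).1).isClosed
        fun hmem => h ((M.mem_facesOf.1 he).2 hmem)
  filter_upwards [hindicator, hshadows] with s hs hs'
  rw [crossingDefect, hs, Finset.sum_congr rfl fun e he => by rw [hs' e he], crossingDefect]

open Classical in
lemma IsRegularAt.eventually_indicator_sub_sign_mul_indicator_shadow {e : Set (Pt d)}
    (hreg : M.IsRegularAt T e (x + s₀ • v)) (hT : T ∈ M.elems) (he : e ∈ M.faces)
    (heT : e ⊆ frontier T) (hv : inner ℝ (M.normal T e) v ≠ 0) (hmem : x + s₀ • v ∈ e) :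
    ∀ᶠ s in 𝓝[≠] s₀, T.indicator (1 : Pt d → ℝ) (x + s • v) -
      SignType.sign (inner ℝ (M.normal T e) v) *
        (shadow e v).indicator (1 : Pt d → ℝ) (x + s • v) =
      if inner ℝ (M.normal T e) v < 0 then 1 else 0 := by
  have hcont : Continuous fun s : ℝ => x + s • v := by fun_prop
  filter_upwards [(hcont.continuousAt.eventually (hreg.eventually_mem_interior_and_notMem hT he heT
    hmem)).filter_mono nhdsWithin_le_nhds, self_mem_nhdsWithin] with s hside hs
  rw [add_sub_add_left_eq_sub, ← sub_smul, inner_smul_right] at hside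
  obtain hlt | hgt := lt_or_gt_of_ne (show s ≠ s₀ from hs)
  · have hshadow : (shadow e v).indicator (1 : Pt d → ℝ) (x + s • v) = 1 :=
      Set.indicator_of_mem (add_smul_mem_shadow.2 ⟨s₀, hlt, hmem⟩) _
    obtain hneg | hpos := lt_or_gt_of_ne hv
    · have hout := hside.2 (mul_pos_of_neg_of_neg (sub_neg.2 hlt) hneg)
      simp [hshadow, hout, hneg]
    · have hin := interior_subset (hside.1 (mul_neg_of_neg_of_pos (sub_neg.2 hlt) hpos))
      simp [hshadow, hin, hpos, hpos.le]
  · have hshadow : (shadow e v).indicator (1 : Pt d → ℝ) (x + s • v) = 0 :=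
      Set.indicator_of_notMem (add_smul_notMem_shadow_of_lt
        (M.isOutwardUnitNormal T hT e he heT).orthogonal hv hmem hgt) _
    obtain hneg | hpos := lt_or_gt_of_ne hv
    · have hin := interior_subset (hside.1 (mul_neg_of_pos_of_neg (sub_pos.2 hgt) hneg))
      simp [hshadow, hin, hneg]
    · have hout := hside.2 (mul_pos (sub_pos.2 hgt) hpos)
      simp [hshadow, hout, hpos.le]

lemma IsRegularAt.exists_eventually_crossingDefect_eq {e : Set (Pt d)}
    (hreg : M.IsRegularAt T e (x + s₀ • v)) (hT : T ∈ M.elems) (he : e ∈ M.faces)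
    (heT : e ⊆ frontier T) (hv : inner ℝ (M.normal T e) v ≠ 0) (hmem : x + s₀ • v ∈ e) :
    ∃ c, ∀ᶠ s in 𝓝[≠] s₀, M.crossingDefect T v (x + s • v) = c := by
  classical
  have hothers : ∀ᶠ s in 𝓝 s₀, ∀ e' ∈ (M.facesOf T).erase e,
      (shadow e' v).indicator (1 : Pt d → ℝ) (x + s • v) =
        (shadow e' v).indicator 1 (x + s₀ • v) :=
    (Filter.eventually_all_finset _).2 fun e' he' => by
      obtain ⟨hne, he'T⟩ := Finset.mem_erase.1 he'
      have heM := (M.mem_facesOf.1 he'T).1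
      exact eventually_indicator_shadow_eq (M.isCompact_face heM).isClosed
        fun hmem' => hne (hreg.eq_of_mem e' heM hmem')
  refine ⟨(if inner ℝ (M.normal T e) v < 0 then 1 else 0) - ∑ e' ∈ (M.facesOf T).erase e,
    SignType.sign (inner ℝ (M.normal T e') v) *
      (shadow e' v).indicator (1 : Pt d → ℝ) (x + s₀ • v), ?_⟩
  filter_upwards [hreg.eventually_indicator_sub_sign_mul_indicator_shadow M hT he heT hv hmem,
    hothers.filter_mono nhdsWithin_le_nhds] with s hs hs'
  rw [crossingDefect, ← Finset.add_sum_erase _ _ (M.mem_facesOf.2 ⟨he, heT⟩), ← sub_sub, hs,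
    Finset.sum_congr rfl fun e' he' => by rw [hs' e' he']]

lemma eventually_atTop_crossingDefect_eq_zero (hT : T ∈ M.elems) (hv : v ≠ 0) (x : Pt d) :
    ∀ᶠ s : ℝ in Filter.atTop, M.crossingDefect T v (x + s • v) = 0 := by
  have hescape : Filter.Tendsto (fun s : ℝ => x + s • v) Filter.atTop (Filter.cocompact _) :=
    ((Homeomorph.addLeft x).isClosedEmbedding.comp
      (isClosedEmbedding_smul_left hv)).tendsto_cocompact.mono_left atTop_le_cocompact
  obtain ⟨S, hS⟩ := Filter.eventually_atTop.1
    (hescape.eventually (M.isCompact_elem hT).compl_mem_cocompact)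
  filter_upwards [Filter.eventually_ge_atTop S] with s hs
  rw [crossingDefect, Set.indicator_of_notMem (hS s hs), zero_sub, neg_eq_zero]
  refine Finset.sum_eq_zero fun e he => ?_
  rw [Set.indicator_of_notMem, mul_zero]
  rw [add_smul_mem_shadow]
  rintro ⟨u, hu, hmem⟩
  exact hS u (hs.trans hu.le) ((M.isClosed_elem hT).frontier_subset ((M.mem_facesOf.1 he).2 hmem))

lemma ae_crossingDefect_eq_zero (hT : T ∈ M.elems) (hv : v ≠ 0) :
    ∀ᵐ x : Pt d, M.crossingDefect T v x = 0 := by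
  filter_upwards [M.ae_line_transversal v,
    measure_eq_zero_iff_ae_notMem.1 (M.volume_frontier_elem hT)] with x hx hxT
  obtain ⟨c, hc⟩ : ∃ c, ∀ s₀ : ℝ, ∀ᶠ s in 𝓝[≠] s₀, M.crossingDefect T v (x + s • v) = c := by
    refine exists_forall_eventually_eq fun s₀ => ?_
    by_cases hs₀ : x + s₀ • v ∈ frontier T
    · obtain ⟨e, he, heT, hmem⟩ := M.exists_face_of_mem_frontier hT hs₀
      obtain ⟨hve, hreg⟩ := hx T hT e he heT s₀ hmem
      exact hreg.exists_eventually_crossingDefect_eq M hT he heT hve hmem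
    · exact ⟨_, (M.eventually_crossingDefect_eq_of_notMem_frontier hT hs₀).filter_mono
        nhdsWithin_le_nhds⟩
  obtain ⟨S, hS⟩ := Filter.eventually_atTop.1 (M.eventually_atTop_crossingDefect_eq_zero hT hv x)
  obtain ⟨s, hsc, hsS⟩ := ((hc (S + 1)).and
    (mem_nhdsWithin_of_mem_nhds (Ioi_mem_nhds (lt_add_one S)))).exists
  obtain ⟨t, htc, ht0⟩ := ((hc 0).and ((M.eventually_crossingDefect_eq_of_notMem_frontier hT
    (by simpa using hxT)).filter_mono nhdsWithin_le_nhds)).exists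
  rw [htc, zero_smul, add_zero] at ht0
  rw [← ht0, ← hsc, hS s (le_of_lt hsS)]

/-- Writing the indicator of `T` as a signed sum of indicators of shadows reduces the claim to the
fundamental theorem of calculus on the lines parallel to `v`. -/
theorem setIntegral_fderiv_of_hasCompactSupport (hT : T ∈ M.elems) {f : Pt d → ℝ}
    (hf : ContDiff ℝ 1 f) (hfc : HasCompactSupport f) (v : Pt d) :
    ∫ x in T, fderiv ℝ f x v = ∑ e ∈ M.facesOf T,
      inner ℝ (M.normal T e) v * ∫ x in e, f x ∂(μHE[d - 1] : Measure (Pt d)) := by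
  obtain rfl | hv := eq_or_ne v 0
  · simp
  have hface {e : Set (Pt d)} (he : e ∈ M.facesOf T) (hve : inner ℝ (M.normal T e) v ≠ 0) :
      MeasurableSet (shadow e v) ∧ ∫ x in shadow e v, fderiv ℝ f x v =
        |inner ℝ (M.normal T e) v| * ∫ x in e, f x ∂(μHE[d - 1] : Measure (Pt d)) := by
    obtain ⟨heM, heT⟩ := M.mem_facesOf.1 he
    obtain ⟨x₀, hx₀⟩ := (M.face_polyhedral e heM).nonempty
    have hem := (M.isCompact_face heM).measurableSet
    have hsub := M.face_subset_hyperplane hT heM heT hx₀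
    refine ⟨measurableSet_shadow hem hsub hve, ?_⟩
    rw [setIntegral_shadow_fderiv hem hsub (M.norm_normal hT heM heT) hve hf hfc,
      finrank_euclideanSpace_fin]
  have hdecomp : ∀ᵐ x, T.indicator (fun x => fderiv ℝ f x v) x =
      ∑ e ∈ M.facesOf T, SignType.sign (inner ℝ (M.normal T e) v) *
        (shadow e v).indicator (fun x => fderiv ℝ f x v) x := by
    filter_upwards [M.ae_crossingDefect_eq_zero hT hv] with x hx
    have hmul (A : Set (Pt d)) : A.indicator (fun x => fderiv ℝ f x v) x =
        A.indicator (1 : Pt d → ℝ) x * fderiv ℝ f x v := by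
      by_cases h : x ∈ A <;> simp [h]
    simp only [hmul, sub_eq_zero.1 hx, Finset.sum_mul, mul_assoc]
  rw [← integral_indicator (M.isCompact_elem hT).measurableSet, integral_congr_ae hdecomp,
    integral_finsetSum _ fun e he => ?_]
  · refine Finset.sum_congr rfl fun e he => ?_
    obtain hve | hve := eq_or_ne (inner ℝ (M.normal T e) v) 0
    · simp [hve]
    · rw [integral_const_mul, integral_indicator (hface he hve).1, (hface he hve).2, ← mul_assoc,
        sign_mul_abs]
  · obtain hve | hve := eq_or_ne (inner ℝ (M.normal T e) v) 0
    · simp [hve]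
    · exact ((integrable_fderiv_apply hf hfc v).indicator (hface he hve).1).const_mul _

theorem setIntegral_fderiv (hT : T ∈ M.elems) {f : Pt d → ℝ} (hf : ContDiff ℝ 1 f) (v : Pt d) :
    ∫ x in T, fderiv ℝ f x v = ∑ e ∈ M.facesOf T,
      inner ℝ (M.normal T e) v * ∫ x in e, f x ∂(μHE[d - 1] : Measure (Pt d)) := by
  obtain ⟨R, hR0, hR⟩ := (M.isCompact_elem hT).isBounded.subset_ball_lt 0 0
  let χ : ContDiffBump (0 : Pt d) := ⟨R, R + 1, hR0, lt_add_one R⟩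
  have hχ : ∀ x ∈ T, (fun x => χ x * f x) =ᶠ[𝓝 x] f := fun x hx => by
    filter_upwards [Metric.isOpen_ball.mem_nhds (hR hx)] with y hy
    rw [χ.one_of_mem_closedBall (Metric.ball_subset_closedBall hy), one_mul]
  have hcutoff := M.setIntegral_fderiv_of_hasCompactSupport hT (f := fun x => χ x * f x)
    (χ.contDiff.mul hf) χ.hasCompactSupport.mul_right v
  rw [setIntegral_congr_fun (M.isCompact_elem hT).measurableSet fun x hx => by
    rw [(hχ x hx).fderiv_eq]] at hcutoff
  rw [hcutoff]
  refine Finset.sum_congr rfl fun e he => ?_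
  obtain ⟨heM, heT⟩ := M.mem_facesOf.1 he
  rw [setIntegral_congr_fun (M.isCompact_face heM).measurableSet fun x hx =>
    (hχ x ((M.isClosed_elem hT).frontier_subset (heT hx))).eq_of_nhds]

end PolytopalMesh

namespace PolytopalMesh

variable {d : ℕ} {Ω : Set (Pt d)} (M : PolytopalMesh Ω) {T T' e : Set (Pt d)}

/-! ### Green's formula for polynomials -/

lemma integrableOn_elem (hT : T ∈ M.elems) {f : Pt d → ℝ} (hf : Continuous f) :
    IntegrableOn f T :=
  hf.continuousOn.integrableOn_compact (M.isCompact_elem hT)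

lemma integrable_faceMeasure (e : M.faces) {f : e.1 → ℝ} (hf : Continuous f) :
    Integrable f (faceMeasure e.1) :=
  hf.integrable_of_hasCompactSupport (HasCompactSupport.of_compactSpace f)

lemma boundaryIntegral_eq_sum (F : Set (Pt d) → Pt d → ℝ) :
    M.boundaryIntegral T (fun e x => F e.1 x) =
      ∑ e ∈ M.facesOf T, ∫ x in e, F e x ∂(μHE[d - 1] : Measure (Pt d)) := by
  classical
  simp only [boundaryIntegral, facesOf, Finset.sum_filter]
  rw [← Finset.sum_coe_sort M.faces]
  exact Finset.sum_congr rfl fun e _ => by rw [M.integral_faceMeasure e.2]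

lemma boundaryIntegral_sub {F G : (e : M.faces) → e.1 → ℝ}
    (hF : ∀ e, Integrable (F e) (faceMeasure e.1)) (hG : ∀ e, Integrable (G e) (faceMeasure e.1)) :
    M.boundaryIntegral T (fun e x => F e x - G e x) =
      M.boundaryIntegral T F - M.boundaryIntegral T G := by
  simp only [boundaryIntegral, ← Finset.sum_sub_distrib]
  exact Finset.sum_congr rfl fun e _ => integral_sub (hF e) (hG e)

lemma continuous_dirDeriv (p : Poly d) (n : Pt d) : Continuous (dirDeriv p n) := by
  unfold dirDeriv
  fun_prop

lemma integral_divergence (hT : T ∈ M.elems) (F : Fin d → Poly d) :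
    ∫ x in T, evalAt (∑ i, MvPolynomial.pderiv i (F i)) x =
      M.boundaryIntegral T fun e x => ∑ i, evalAt (F i) x * M.normal T e.1 i := by
  have hcoord (i : Fin d) : ∫ x in T, evalAt (MvPolynomial.pderiv i (F i)) x =
      ∑ e ∈ M.facesOf T, ∫ x in e, evalAt (F i) x * M.normal T e i
        ∂(μHE[d - 1] : Measure (Pt d)) := by
    have hdiv := M.setIntegral_fderiv hT (contDiff_evalAt (F i)) (EuclideanSpace.single i 1)
    simp only [fderiv_evalAt, ← evalAt_dirDerivation, dirDerivation_single] at hdiv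
    rw [hdiv]
    refine Finset.sum_congr rfl fun e _ => ?_
    rw [integral_mul_const, mul_comm]
    simp [EuclideanSpace.inner_single_right]
  simp only [evalAt_sum]
  rw [M.boundaryIntegral_eq_sum fun e x => ∑ i, evalAt (F i) x * M.normal T e i,
    integral_finsetSum _ fun i _ => M.integrableOn_elem hT (continuous_evalAt _),
    Finset.sum_congr rfl fun i _ => hcoord i, Finset.sum_comm]
  refine Finset.sum_congr rfl fun e he => (integral_finsetSum _ fun i _ => ?_).symm
  have heM := (M.mem_facesOf.1 he).1
  exact ((continuous_evalAt _).mul continuous_const).continuousOn.integrableOn_of_subset_isCompact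
    (M.isCompact_face heM) (M.isCompact_face heM).measurableSet subset_rfl
    (M.measure_face_lt_top heM).ne

theorem green (hT : T ∈ M.elems) (p φ : Poly d) :
    (∫ x in T, evalAt p x * evalAt (lap φ) x)
      - M.boundaryIntegral T (fun e x => evalAt p x * dirDeriv φ (M.normal T e.1) x)
      + M.boundaryIntegral T (fun e x => dirDeriv p (M.normal T e.1) x * evalAt φ x) =
    ∫ x in T, evalAt (lap p) x * evalAt φ x := by
  have hdiv : ∑ i, MvPolynomial.pderiv i
      (p * MvPolynomial.pderiv i φ - MvPolynomial.pderiv i p * φ) = p * lap φ - lap p * φ := by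
    simp only [lap, Finset.mul_sum, Finset.sum_mul, ← Finset.sum_sub_distrib, map_sub,
      Derivation.leibniz, smul_eq_mul]
    exact Finset.sum_congr rfl fun i _ => by ring
  have hnormal (n x : Pt d) :
      ∑ i, (evalAt p x * evalAt (MvPolynomial.pderiv i φ) x -
        evalAt (MvPolynomial.pderiv i p) x * evalAt φ x) * n i =
        evalAt p x * dirDeriv φ n x - dirDeriv p n x * evalAt φ x := by
    simp only [dirDeriv, Finset.mul_sum, Finset.sum_mul, ← Finset.sum_sub_distrib]
    exact Finset.sum_congr rfl fun i _ => by ring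
  have key := M.integral_divergence hT
    fun i => p * MvPolynomial.pderiv i φ - MvPolynomial.pderiv i p * φ
  simp only [hdiv, hnormal, evalAt_sub, evalAt_mul] at key
  rw [integral_sub (M.integrableOn_elem hT (by fun_prop)) (M.integrableOn_elem hT (by fun_prop)),
    M.boundaryIntegral_sub] at key
  · linarith
  · exact fun e => M.integrable_faceMeasure e
      (((continuous_evalAt p).mul (continuous_dirDeriv _ _)).comp continuous_subtype_val)
  · exact fun e => M.integrable_faceMeasure e
      (((continuous_dirDeriv _ _).mul (continuous_evalAt φ)).comp continuous_subtype_val)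

/-! ### Polynomials on elements and faces -/

lemma eq_zero_of_eqOn_interior (hT : T ∈ M.elems) {p : Poly d}
    (h : ∀ x ∈ interior T, evalAt p x = 0) : p = 0 := by
  obtain ⟨x₀, hx₀⟩ := (M.elem_connected T hT).nonempty
  have hzero := (analyticOnNhd_evalAt p).eqOn_zero_of_preconnected_of_eventuallyEq_zero
    isPreconnected_univ (Set.mem_univ x₀)
    (by filter_upwards [isOpen_interior.mem_nhds hx₀] with x hx using h x hx)
  exact eq_zero_of_evalAt_eq_zero fun x => hzero (Set.mem_univ x)

lemma eq_zero_of_integral_mul_self_eq_zero (hT : T ∈ M.elems) {p : Poly d}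
    (h : ∫ x in T, evalAt p x * evalAt p x = 0) : p = 0 := by
  have hcont : Continuous fun x => evalAt p x * evalAt p x := by fun_prop
  rw [integral_eq_zero_iff_of_nonneg (fun x => mul_self_nonneg _)
    (M.integrableOn_elem hT hcont)] at h
  have hzero := Measure.eqOn_open_of_ae_eq
    (ae_restrict_of_ae_restrict_of_subset interior_subset h) isOpen_interior hcont.continuousOn
    continuousOn_const
  exact M.eq_zero_of_eqOn_interior hT fun x hx => mul_self_eq_zero.1 (hzero hx)

lemma evalAt_eq_zero_on_hyperplane (hT : T ∈ M.elems) (he : e ∈ M.faces) (heT : e ⊆ frontier T)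
    {x₀ : Pt d} (hx₀ : x₀ ∈ e) {p : Poly d} (hp : ∀ x ∈ e, evalAt p x = 0) {w : Pt d}
    (hw : w ∈ perp (M.normal T e)) : evalAt p (x₀ + w) = 0 := by
  have hdense := (M.face_polyhedral e he).preimage_subset_closure_interior
    (isometry_hyperplaneMap (M.normal T e) x₀).injective
    (by rw [finrank_perp (M.normal_ne_zero hT he heT), finrank_euclideanSpace_fin])
    (M.face_subset_hyperplane hT he heT hx₀)
  have hx₀' : (0 : perp (M.normal T e)) ∈ hyperplaneMap (M.normal T e) x₀ ⁻¹' e := by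
    simpa [hyperplaneMap_apply] using hx₀
  obtain ⟨w₀, hw₀⟩ := closure_nonempty_iff.1 ⟨_, hdense hx₀'⟩
  refine evalAt_eq_zero_of_eventually (w₀ := w₀) ?_ w hw
  filter_upwards [mem_interior_iff_mem_nhds.1 hw₀] with w hw
  rw [← hyperplaneMap_apply]
  exact hp _ hw

lemma eq_zero_of_lap_eq_zero_of_cauchy_on_face (hT : T ∈ M.elems) (he : e ∈ M.faces)
    (heT : e ⊆ frontier T) {p : Poly d} (hlap : lap p = 0) (hp : ∀ x ∈ e, evalAt p x = 0)
    (hDp : ∀ x ∈ e, dirDeriv p (M.normal T e) x = 0) : p = 0 := by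
  obtain ⟨x₀, hx₀⟩ := (M.face_polyhedral e he).nonempty
  refine eq_zero_of_lap_eq_zero_of_cauchy (x₀ := x₀) (M.norm_normal hT he heT) hlap
    (fun w hw => M.evalAt_eq_zero_on_hyperplane hT he heT hx₀ hp hw)
    (fun w hw => M.evalAt_eq_zero_on_hyperplane hT he heT hx₀ (fun x hx => ?_) hw)
  rw [evalAt_dirDerivation, hDp x hx]

/-! ### Adjacent elements -/

lemma normal_mem_span_normal (hT : T ∈ M.elems) (hT' : T' ∈ M.elems) (he : e ∈ M.faces)
    (heT : e ⊆ frontier T) (heT' : e ⊆ frontier T') :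
    M.normal T' e ∈ Submodule.span ℝ {M.normal T e} := by
  obtain ⟨x₀, hx₀⟩ := (M.face_polyhedral e he).nonempty
  set n' := M.normal T' e
  let q : Poly d := ∑ i, MvPolynomial.C (n' i) * (MvPolynomial.X i - MvPolynomial.C (x₀ i))
  have hq (x : Pt d) : evalAt q x = inner ℝ n' (x - x₀) := by
    simp [q, evalAt, PiLp.inner_apply, mul_comm]
  rw [← Submodule.orthogonal_orthogonal (Submodule.span ℝ {M.normal T e}),
    Submodule.mem_orthogonal']
  intro w hw
  have hw0 := M.evalAt_eq_zero_on_hyperplane hT he heT hx₀ (p := q) (fun x hx => by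
    rw [hq, (M.isOutwardUnitNormal T' hT' e he heT').orthogonal x hx x₀ hx₀]) hw
  rwa [hq, add_sub_cancel_left] at hw0

lemma normal_ne_normal (hT : T ∈ M.elems) (hT' : T' ∈ M.elems) (hne : T ≠ T') (he : e ∈ M.faces)
    (heT : e ⊆ frontier T) (heT' : e ⊆ frontier T') : M.normal T' e ≠ M.normal T e := by
  intro hn
  have hpos : (μHE[d - 1] : Measure (Pt d)) e ≠ 0 := by
    have := M.measure_face_inter_pos he isOpen_univ
      (by simpa using (M.face_polyhedral e he).nonempty)
    simpa using this.ne'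
  have : (ae ((μHE[d - 1] : Measure (Pt d)).restrict e)).NeBot := by
    rwa [ae_neBot, Ne, Measure.restrict_eq_zero]
  obtain ⟨x, hx, hx'⟩ := ((M.isOutwardUnitNormal T hT e he heT).outward.and
    (M.isOutwardUnitNormal T' hT' e he heT').outward).exists
  obtain ⟨t, ht, ht'⟩ := (hx.and hx').exists
  rw [hn] at ht'
  exact Set.disjoint_left.1 (M.elem_disjoint T hT T' hT' hne) ht.1 ht'.1

lemma normal_eq_neg (hT : T ∈ M.elems) (hT' : T' ∈ M.elems) (hne : T ≠ T') (he : e ∈ M.faces)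
    (heT : e ⊆ frontier T) (heT' : e ⊆ frontier T') : M.normal T' e = -M.normal T e := by
  obtain ⟨c, hc⟩ := Submodule.mem_span_singleton.1 (M.normal_mem_span_normal hT hT' he heT heT')
  have habs : |c| = 1 := by
    have := M.norm_normal hT' he heT'
    rwa [← hc, norm_smul, M.norm_normal hT he heT, mul_one, Real.norm_eq_abs] at this
  rcases eq_or_eq_neg_of_abs_eq habs with rfl | rfl
  · rw [one_smul] at hc
    exact absurd hc.symm (M.normal_ne_normal hT hT' hne he heT heT')
  · rw [← hc, neg_smul, one_smul]

lemma exists_neighbour (T : Set (Pt d)) (he : e ∈ M.faces) (hb : ¬ e ⊆ frontier Ω) :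
    ∃ T' ∈ M.elems, e ⊆ frontier T' ∧ T ≠ T' := by
  obtain ⟨T', ⟨hT', heT'⟩, hne⟩ := Set.exists_ne_of_one_lt_ncard
    (by rw [M.interior_face e he hb]; exact one_lt_two) T
  exact ⟨T', hT', heT', hne.symm⟩

lemma disjoint_interior_elem (hT : T ∈ M.elems) (hT' : T' ∈ M.elems) (hne : T ≠ T') :
    Disjoint (interior T) T' :=
  ((M.elem_disjoint T hT T' hT' hne).closure_right isOpen_interior).mono_right
    (M.elem_polyhedral T' hT').subset_closure_interior

lemma mem_interior_union (hT : T ∈ M.elems) (hT' : T' ∈ M.elems) (hne : T ≠ T') (he : e ∈ M.faces)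
    (heT : e ⊆ frontier T) (heT' : e ⊆ frontier T') {p : Pt d} (hp : p ∈ e)
    (hreg : M.IsRegularAt T e p) (hreg' : M.IsRegularAt T' e p) : p ∈ interior (T ∪ T') := by
  have hsides := (hreg.eventually_mem_interior_and_notMem hT he heT hp).and
    (hreg'.eventually_mem_interior_and_notMem hT' he heT' hp)
  rw [M.normal_eq_neg hT hT' hne he heT heT', ← eventually_eventually_nhds] at hsides
  set n := M.normal T e
  have hn : ‖n‖ = 1 := M.norm_normal hT he heT
  rw [mem_interior_iff_mem_nhds]
  filter_upwards [hsides] with y hy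
  obtain ⟨hneg, hpos⟩ := hy.self_of_nhds
  rcases lt_trichotomy (inner ℝ n (y - p)) 0 with hlt | heq | hgt
  · exact Or.inl (interior_subset (hneg.1 hlt))
  · left
    have htend : Filter.Tendsto (fun s : ℝ => y - s • n) (𝓝[>] 0) (𝓝 y) :=
      ((by fun_prop : Continuous fun s : ℝ => y - s • n).tendsto' 0 y
        (by simp)).mono_left nhdsWithin_le_nhds
    refine (M.isClosed_elem hT).mem_of_tendsto htend ?_
    filter_upwards [htend.eventually hy, self_mem_nhdsWithin] with s hs (hs0 : 0 < s)
    refine interior_subset (hs.1.1 ?_)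
    rw [sub_right_comm, inner_sub_right, heq, inner_smul_right, real_inner_self_eq_norm_sq, hn]
    simpa using hs0
  · exact Or.inr (interior_subset (hpos.1 (by rw [inner_neg_left]; linarith)))

/-! ### Connectedness of the mesh through interior faces -/

/-- The union of the elements of the mesh that belong to `A`. -/
def elemUnion (A : Set (Set (Pt d))) : Set (Pt d) := ⋃ T ∈ {T | T ∈ M.elems ∧ T ∈ A}, T

/-- `A` contains, with an element of the mesh, all the elements that share an interior face with
it. -/
def IsClosedUnderNeighbours (A : Set (Set (Pt d))) : Prop :=
  ∀ e ∈ M.faces, ¬ e ⊆ frontier Ω → ∀ T ∈ M.elems, ∀ T' ∈ M.elems, T ≠ T' →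
    e ⊆ frontier T → e ⊆ frontier T' → T ∈ A → T' ∈ A

variable {A : Set (Set (Pt d))}

variable {M} in
lemma IsClosedUnderNeighbours.compl (hA : M.IsClosedUnderNeighbours A) :
    M.IsClosedUnderNeighbours Aᶜ :=
  fun e he hb T hT T' hT' hne heT heT' hTA hTA' =>
    hTA (hA e he hb T' hT' T hT hne.symm heT' heT hTA')

lemma mem_elemUnion {x : Pt d} : x ∈ M.elemUnion A ↔ ∃ T ∈ M.elems, T ∈ A ∧ x ∈ T := by
  simp [elemUnion, and_assoc]

lemma subset_elemUnion (hT : T ∈ M.elems) (hTA : T ∈ A) : T ⊆ M.elemUnion A := fun _ hx =>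
  M.mem_elemUnion.2 ⟨T, hT, hTA, hx⟩

lemma isClosed_elemUnion : IsClosed (M.elemUnion A) :=
  (M.elems.finite_toSet.subset fun _ hT => hT.1).isClosed_biUnion fun _ hT => M.isClosed_elem hT.1

lemma elemUnion_subset_closure_interior : M.elemUnion A ⊆ closure (interior (M.elemUnion A)) := by
  intro x hx
  obtain ⟨T, hT, hTA, hxT⟩ := M.mem_elemUnion.1 hx
  exact closure_mono (interior_mono (M.subset_elemUnion hT hTA))
    ((M.elem_polyhedral T hT).subset_closure_interior hxT)

lemma exists_elem_of_mem {x : Pt d} (hx : x ∈ Ω) : ∃ T ∈ M.elems, x ∈ T := by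
  have hx := subset_closure hx
  rw [← M.iUnion_elems] at hx
  exact bex_def.1 (Set.mem_iUnion₂.1 hx)

lemma nonempty_inter_elemUnion (hA : ∃ T ∈ M.elems, T ∈ A) : (Ω ∩ M.elemUnion A).Nonempty := by
  obtain ⟨T, hT, hTA⟩ := hA
  obtain ⟨x, hx⟩ := (M.elem_connected T hT).nonempty
  have hxΩ : x ∈ closure Ω := by
    rw [← M.iUnion_elems]
    exact Set.mem_biUnion (t := id) hT (interior_subset hx)
  obtain ⟨y, hy, hyΩ⟩ := mem_closure_iff.1 hxΩ _ isOpen_interior hx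
  exact ⟨y, hyΩ, M.subset_elemUnion hT hTA (interior_subset hy)⟩

lemma disjoint_interior_elemUnion_compl :
    Disjoint (interior (M.elemUnion A)) (interior (M.elemUnion Aᶜ)) := by
  rw [Set.disjoint_iff_inter_eq_empty,
    ← (isOpen_interior.inter isOpen_interior).measure_eq_zero_iff (volume : Measure (Pt d))]
  refine measure_mono_null ?_ M.volume_iUnion_faces
  rintro q ⟨hqA, hqAc⟩
  obtain ⟨S, hS, hSA, hqS⟩ := M.mem_elemUnion.1 (interior_subset hqA)
  obtain ⟨S', hS', hSA', hqS'⟩ := M.mem_elemUnion.1 (interior_subset hqAc)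
  have hne : S ≠ S' := ne_of_mem_of_not_mem hSA hSA'
  have hfr : q ∈ frontier S := by
    rw [mem_frontier_iff_notMem_interior hqS]
    exact fun h => Set.disjoint_left.1 (M.disjoint_interior_elem hS hS' hne) h hqS'
  obtain ⟨e, he, -, hqe⟩ := M.exists_face_of_mem_frontier hS hfr
  exact Set.mem_biUnion he hqe

lemma mem_interior_elemUnion (hΩ : IsOpen Ω) (hA : M.IsClosedUnderNeighbours A) (hT : T ∈ M.elems)
    (hTA : T ∈ A) {x : Pt d} (hxΩ : x ∈ Ω) (hxT : x ∈ T)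
    (hreg : ∀ T ∈ M.elems, ∀ e ∈ M.faces, e ⊆ frontier T → x ∈ e → M.IsRegularAt T e x) :
    x ∈ interior (M.elemUnion A) := by
  by_cases hfr : x ∈ frontier T
  · obtain ⟨e, he, heT, hxe⟩ := M.exists_face_of_mem_frontier hT hfr
    have hb : ¬ e ⊆ frontier Ω := fun h => by
      have := h hxe
      rw [hΩ.frontier_eq] at this
      exact this.2 hxΩ
    obtain ⟨T', hT', heT', hne⟩ := M.exists_neighbour T he hb
    refine interior_mono (Set.union_subset (M.subset_elemUnion hT hTA)
      (M.subset_elemUnion hT' (hA e he hb T hT T' hT' hne heT heT' hTA))) ?_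
    exact M.mem_interior_union hT hT' hne he heT heT' hxe (hreg T hT e he heT hxe)
      (hreg T' hT' e he heT' hxe)
  · exact interior_mono (M.subset_elemUnion hT hTA)
      ((mem_interior_iff_notMem_frontier hxT).2 hfr)

/-- Otherwise some small segment inside `Ω` leads from the elements in `A` to those outside `A`. A
generic such segment meets the mesh skeleton in regular points only, so that it is covered by the
disjoint open sets `interior (M.elemUnion A)` and `interior (M.elemUnion Aᶜ)`. -/
theorem mem_of_isClosedUnderNeighbours (hΩo : IsOpen Ω) (hΩc : IsPreconnected Ω)
    (hA : M.IsClosedUnderNeighbours A) (hne : ∃ T ∈ M.elems, T ∈ A) (hT : T ∈ M.elems) :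
    T ∈ A := by
  by_contra hTA
  have hcover {x : Pt d} (hx : x ∈ Ω) :
      (∃ T ∈ M.elems, T ∈ A ∧ x ∈ T) ∨ ∃ T ∈ M.elems, T ∈ Aᶜ ∧ x ∈ T := by
    obtain ⟨T, hT, hxT⟩ := M.exists_elem_of_mem hx
    by_cases hTA : T ∈ A
    exacts [Or.inl ⟨T, hT, hTA, hxT⟩, Or.inr ⟨T, hT, hTA, hxT⟩]
  obtain ⟨p, hpΩ, hpA, hpAc⟩ := isPreconnected_closed_iff.1 hΩc _ _ M.isClosed_elemUnion
    M.isClosed_elemUnion (fun x hx => (hcover hx).imp M.mem_elemUnion.2 M.mem_elemUnion.2)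
    (M.nonempty_inter_elemUnion hne) (M.nonempty_inter_elemUnion ⟨T, hT, hTA⟩)
  obtain ⟨r, hr, hball⟩ := Metric.isOpen_iff.1 hΩo p hpΩ
  have hmeets {B : Set (Set (Pt d))} (hpB : p ∈ M.elemUnion B) :
      (Metric.ball p r ∩ interior (M.elemUnion B)).Nonempty :=
    mem_closure_iff.1 (M.elemUnion_subset_closure_interior hpB) _ Metric.isOpen_ball
      (Metric.mem_ball_self hr)
  obtain ⟨x, hx⟩ := hmeets hpA
  obtain ⟨y, hy⟩ := hmeets hpAc
  have hopen (B : Set (Set (Pt d))) : IsOpen (Metric.ball p r ∩ interior (M.elemUnion B)) :=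
    Metric.isOpen_ball.inter isOpen_interior
  obtain ⟨z, ⟨⟨hzball, hzA⟩, hzvball, hzvAc⟩, hz⟩ :=
    (Measure.dense_of_ae (M.ae_line_transversal (y - x))).inter_open_nonempty _
      ((hopen A).inter ((hopen Aᶜ).preimage (continuous_add_const (y - x))))
      ⟨x, hx, by simpa using hy⟩
  have hseg : (fun t : ℝ => z + t • (y - x)) '' Set.Icc 0 1 ⊆
      interior (M.elemUnion A) ∪ interior (M.elemUnion Aᶜ) := by
    rintro _ ⟨t, ht, rfl⟩
    have hmemΩ : z + t • (y - x) ∈ Ω := hball <|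
      (convex_ball p r).add_smul_mem hzball hzvball ht
    have hreg := fun T hT e he heT hmem => (hz T hT e he heT t hmem).2
    rcases hcover hmemΩ with ⟨S, hS, hSA, hmem⟩ | ⟨S, hS, hSA, hmem⟩
    · exact Or.inl (M.mem_interior_elemUnion hΩo hA hS hSA hmemΩ hmem hreg)
    · exact Or.inr (M.mem_interior_elemUnion hΩo hA.compl hS hSA hmemΩ hmem hreg)
  obtain ⟨q, -, hqA, hqAc⟩ := (isPreconnected_Icc.image _ (by fun_prop)) _ _ isOpen_interior
    isOpen_interior hseg ⟨z, ⟨0, by simp, by simp⟩, hzA⟩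
    ⟨z + (y - x), ⟨1, by simp, by simp⟩, hzvAc⟩
  exact Set.disjoint_left.1 M.disjoint_interior_elemUnion_compl hqA hqAc

theorem eq_zero_of_piecewise_harmonic (hΩo : IsOpen Ω) (hΩc : IsPreconnected Ω)
    (w : M.PiecewisePoly) (hlap : ∀ T, lap (w T) = 0)
    (hjump : ∀ e : M.faces, ¬ e.1 ⊆ frontier Ω → ∀ T T' : M.elems, T ≠ T' → e.1 ⊆ frontier T.1 →
      e.1 ⊆ frontier T'.1 → ∀ x ∈ e.1, evalAt (w T) x = evalAt (w T') x ∧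
        dirDeriv (w T) (M.normal T.1 e.1) x = dirDeriv (w T') (M.normal T.1 e.1) x)
    {T₀ : M.elems} (he : e ∈ M.faces) (heT₀ : e ⊆ frontier T₀.1)
    (hw : ∀ x ∈ e, evalAt (w T₀) x = 0)
    (hDw : ∀ x ∈ e, dirDeriv (w T₀) (M.normal T₀.1 e) x = 0) : w = 0 := by
  have hclosed : M.IsClosedUnderNeighbours {T | ∃ hT : T ∈ M.elems, w ⟨T, hT⟩ = 0} := by
    rintro e he hb T hT T' hT' hne heT heT' ⟨_, hwT⟩
    have hmatch := hjump ⟨e, he⟩ hb ⟨T, hT⟩ ⟨T', hT'⟩ (Subtype.coe_ne_coe.1 hne) heT heT'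
    refine ⟨hT', M.eq_zero_of_lap_eq_zero_of_cauchy_on_face hT he heT (hlap _)
      (fun x hx => ?_) fun x hx => ?_⟩
    · rw [← (hmatch x hx).1, hwT, evalAt_zero]
    · rw [← (hmatch x hx).2, hwT]
      simp [dirDeriv]
  ext1 T
  obtain ⟨_, hwT⟩ := M.mem_of_isClosedUnderNeighbours hΩo hΩc hclosed ⟨T₀.1, T₀.2, T₀.2,
    M.eq_zero_of_lap_eq_zero_of_cauchy_on_face T₀.2 he heT₀ (hlap _) hw hDw⟩ T.2
  exact hwT

end PolytopalMesh

/-! ### Integral pairings -/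

section Pairings

variable {X : Type*} [TopologicalSpace X] [MeasurableSpace X] {μ : Measure X}

/-- The functional `φ ↦ ∫ g φ dμ` on continuous functions. -/
def integralMul (g : X → ℝ) (hg : ∀ φ : C(X, ℝ), Integrable (fun x => g x * φ x) μ) :
    C(X, ℝ) →ₗ[ℝ] ℝ where
  toFun φ := ∫ x, g x * φ x ∂μ
  map_add' φ ψ := by
    simp only [ContinuousMap.add_apply, mul_add]
    exact integral_add (hg φ) (hg ψ)
  map_smul' c φ := by
    simp only [ContinuousMap.smul_apply, smul_eq_mul, mul_left_comm, RingHom.id_apply]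
    exact integral_const_mul _ _

/-- The `L²(μ)` inner product of continuous functions. -/
def l2Form (hμ : ∀ f : C(X, ℝ), Integrable f μ) : C(X, ℝ) →ₗ[ℝ] C(X, ℝ) →ₗ[ℝ] ℝ where
  toFun f := integralMul f fun φ => hμ (f * φ)
  map_add' f f' := by
    ext φ
    simp only [integralMul, LinearMap.coe_mk, AddHom.coe_mk, LinearMap.add_apply,
      ContinuousMap.add_apply, add_mul]
    exact integral_add (hμ (f * φ)) (hμ (f' * φ))
  map_smul' c f := by
    ext φ
    simp only [integralMul, LinearMap.coe_mk, AddHom.coe_mk, LinearMap.smul_apply,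
      ContinuousMap.smul_apply, smul_eq_mul, mul_assoc, RingHom.id_apply]
    exact integral_const_mul _ _

lemma l2Form_apply (hμ : ∀ f : C(X, ℝ), Integrable f μ) (f g : C(X, ℝ)) :
    l2Form hμ f g = ∫ x, f x * g x ∂μ := rfl

lemma l2Form_self_nonneg (hμ : ∀ f : C(X, ℝ), Integrable f μ) (f : C(X, ℝ)) :
    0 ≤ l2Form hμ f f :=
  integral_nonneg fun _ => mul_self_nonneg _

lemma eq_zero_of_l2Form_self_eq_zero [μ.IsOpenPosMeasure]
    (hμ : ∀ f : C(X, ℝ), Integrable f μ) {f : C(X, ℝ)} (h : l2Form hμ f f = 0) : f = 0 := by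
  rw [l2Form_apply, integral_eq_zero_iff_of_nonneg (fun x => mul_self_nonneg _) (hμ (f * f))] at h
  have hzero := Measure.eq_of_ae_eq h (f * f).continuous continuous_const
  ext x
  exact mul_self_eq_zero.1 (congrFun hzero x)

end Pairings

lemma existsUnique_of_separatingLeft {K V : Type*} [Field K] [AddCommGroup V] [Module K V]
    [FiniteDimensional K V] {B : V →ₗ[K] V →ₗ[K] K} (hB : B.SeparatingLeft)
    (l : Module.Dual K V) : ∃! v, B v = l := by
  have hinj : Function.Injective (B : V →ₗ[K] Module.Dual K V) :=
    LinearMap.ker_eq_bot.1 (LinearMap.separatingLeft_iff_ker_eq_bot.1 hB)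
  have hsurj := (LinearMap.injective_iff_surjective_of_finrank_eq_finrank
    (Subspace.dual_finrank_eq (K := K) (V := V)).symm).1 hinj
  exact Function.Bijective.existsUnique ⟨hinj, hsurj⟩ l

section PolynomialFunctions

variable {d : ℕ}

/-- A polynomial as a continuous function. -/
def polyCont : Poly d →ₗ[ℝ] C(Pt d, ℝ) where
  toFun p := ⟨evalAt p, continuous_evalAt p⟩
  map_add' p q := by ext x; exact evalAt_add p q x
  map_smul' c p := by ext x; exact evalAt_smul c p x

/-- The restriction of a polynomial to the set `e`, as a continuous function. -/
def polyRes (e : Set (Pt d)) : Poly d →ₗ[ℝ] C(e, ℝ) where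
  toFun p := (polyCont p).restrict e
  map_add' p q := by ext x; exact evalAt_add p q x
  map_smul' c p := by ext x; exact evalAt_smul c p x

/-- The Laplacian as a linear map. -/
def lapLin : Poly d →ₗ[ℝ] Poly d :=
  ∑ i, (MvPolynomial.pderiv i).toLinearMap ∘ₗ (MvPolynomial.pderiv i).toLinearMap

lemma lapLin_apply (p : Poly d) : lapLin p = lap p := by
  simp [lapLin, lap]

/-- `P_r(e)` as a vector space. -/
def polyOnSub (e : Set (Pt d)) (r : ℤ) : Submodule ℝ (e → ℝ) :=
  ((polySpace d r).map (ContinuousMap.coeFnLinearMap ℝ ∘ₗ polyRes e)).copy (polyOn e r) <| by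
    ext q
    exact exists_congr fun p => and_congr_right fun _ => funext_iff.symm.trans eq_comm

instance finiteDimensional_polyOnSub (e : Set (Pt d)) (r : ℤ) :
    FiniteDimensional ℝ (polyOnSub e r) := by
  rw [polyOnSub, Submodule.copy_eq]
  infer_instance

lemma continuous_of_mem_polyOn {e : Set (Pt d)} {r : ℤ} {q : e → ℝ} (hq : q ∈ polyOn e r) :
    Continuous q := by
  obtain ⟨p, -, hp⟩ := hq
  rw [funext hp]
  fun_prop

/-- The inclusion of `P_r(e)` into the continuous functions. -/
def polyOnInclusion (e : Set (Pt d)) (r : ℤ) : polyOnSub e r →ₗ[ℝ] C(e, ℝ) where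
  toFun q := ⟨q.1, continuous_of_mem_polyOn q.2⟩
  map_add' _ _ := rfl
  map_smul' _ _ := rfl

end PolynomialFunctions

namespace PolytopalMesh

variable {d : ℕ} {Ω : Set (Pt d)} (M : PolytopalMesh Ω)

/-- The `L²(e)` inner product of continuous functions. -/
def faceForm (e : M.faces) : C(e.1, ℝ) →ₗ[ℝ] C(e.1, ℝ) →ₗ[ℝ] ℝ :=
  l2Form (μ := faceMeasure e.1) fun f => M.integrable_faceMeasure e f.continuous

/-- The `L²(T)` inner product of continuous functions. -/
def elemForm (T : M.elems) : C(Pt d, ℝ) →ₗ[ℝ] C(Pt d, ℝ) →ₗ[ℝ] ℝ :=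
  l2Form (μ := volume.restrict T.1) fun f => M.integrableOn_elem T.2 f.continuous

lemma faceForm_apply (e : M.faces) (f g : C(e.1, ℝ)) :
    M.faceForm e f g = ∫ x, f x * g x ∂(faceMeasure e.1) := rfl

lemma elemForm_apply (T : M.elems) (f g : C(Pt d, ℝ)) :
    M.elemForm T f g = ∫ x in T.1, f x * g x := rfl

lemma eq_zero_of_faceForm_self_eq_zero (e : M.faces) {f : C(e.1, ℝ)} (h : M.faceForm e f f = 0) :
    f = 0 :=
  eq_zero_of_l2Form_self_eq_zero _ h

/-! ### `L²` projections onto polynomials on a face -/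

lemma integrable_mul_of_integrableOn_face (e : M.faces) {g : Pt d → ℝ}
    (hg : IntegrableOn g e.1 (μHE[d - 1] : Measure (Pt d))) (φ : C(e.1, ℝ)) :
    Integrable (fun x : e.1 => g x * φ x) (faceMeasure e.1) := by
  have hm := (M.isCompact_face e.2).measurableSet
  have hge : Integrable (fun x : e.1 => g x) (faceMeasure e.1) := by
    rw [IntegrableOn, ← map_comap_subtype_coe hm] at hg
    exact (MeasurableEmbedding.subtype_coe hm).integrable_map_iff.1 hg
  simpa using hge.integrableOn.mul_continuousOn φ.continuous.continuousOn isCompact_univ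

/-- The functional `φ ↦ ∫_e g φ ds`. -/
def faceLoad (e : M.faces) {g : Pt d → ℝ}
    (hg : IntegrableOn g e.1 (μHE[d - 1] : Measure (Pt d))) : C(e.1, ℝ) →ₗ[ℝ] ℝ :=
  integralMul (fun x : e.1 => g x) (M.integrable_mul_of_integrableOn_face e hg)

lemma isL2Projection_iff (e : M.faces) {r : ℤ} {g : Pt d → ℝ}
    (hg : IntegrableOn g e.1 (μHE[d - 1] : Measure (Pt d))) (q : polyOnSub e.1 r) :
    IsL2Projection e.1 r g q ↔
      (M.faceForm e).compl₁₂ (polyOnInclusion e.1 r) (polyOnInclusion e.1 r) q =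
        M.faceLoad e hg ∘ₗ polyOnInclusion e.1 r := by
  let ι := polyOnInclusion e.1 r
  have hsub (φ : polyOnSub e.1 r) : ∫ x : e.1, (g x - q.1 x) * φ.1 x ∂(faceMeasure e.1) =
      M.faceLoad e hg (ι φ) - M.faceForm e (ι q) (ι φ) := by
    simp only [sub_mul]
    exact integral_sub (M.integrable_mul_of_integrableOn_face e hg (ι φ))
      (M.integrable_faceMeasure e (ι q * ι φ).continuous)
  constructor
  · rintro ⟨-, h⟩
    ext φ
    exact (sub_eq_zero.1 ((hsub φ).symm.trans (h φ.1 φ.2))).symm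
  · intro h
    refine ⟨q.2, fun φ hφ => (hsub ⟨φ, hφ⟩).trans (sub_eq_zero.2 ?_)⟩
    exact (LinearMap.congr_fun h ⟨φ, hφ⟩).symm

lemma existsUnique_isL2Projection (e : M.faces) (r : ℤ) {g : Pt d → ℝ}
    (hg : IntegrableOn g e.1 (μHE[d - 1] : Measure (Pt d))) :
    ∃! q : e.1 → ℝ, IsL2Projection e.1 r g q := by
  have hsep : ((M.faceForm e).compl₁₂ (polyOnInclusion e.1 r)
      (polyOnInclusion e.1 r)).SeparatingLeft := fun q hq => Subtype.ext <|
    congrArg DFunLike.coe (M.eq_zero_of_faceForm_self_eq_zero e (hq q))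
  obtain ⟨q, hq, huniq⟩ := existsUnique_of_separatingLeft hsep
    (M.faceLoad e hg ∘ₗ polyOnInclusion e.1 r)
  refine ⟨q, (M.isL2Projection_iff e hg q).2 hq, fun q' hq' => ?_⟩
  exact congrArg Subtype.val (huniq ⟨q', hq'.1⟩ ((M.isL2Projection_iff e hg ⟨q', hq'.1⟩).1 hq'))

lemma isL2Projection_zero_iff (e : M.faces) {r : ℤ} {q : e.1 → ℝ} :
    IsL2Projection e.1 r 0 q ↔ q = 0 := by
  have hzero : IsL2Projection e.1 r 0 0 := ⟨(polyOnSub e.1 r).zero_mem, fun φ _ => by simp⟩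
  exact ⟨fun hq => (M.existsUnique_isL2Projection e r integrableOn_zero).unique hq hzero,
    fun hq => hq ▸ hzero⟩

/-! ### The weak finite element spaces as vector spaces -/

lemma vn_add (v w : M.WeakFunction) (T : M.elems) (e : M.faces) :
    (v + w).vn T e = v.vn T e + w.vn T e := by
  ext x; exact inner_add_left _ _ _

lemma vn_smul (c : ℝ) (v : M.WeakFunction) (T : M.elems) (e : M.faces) :
    (c • v).vn T e = c • v.vn T e := by
  ext x; exact real_inner_smul_left _ _ _

lemma vn_zero (T : M.elems) (e : M.faces) : (0 : M.WeakFunction).vn T e = 0 :=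
  funext fun _ => inner_zero_left _

/-- `V_h` as a vector space. -/
def VhSub (k : ℕ) : Submodule ℝ M.WeakFunction where
  carrier := M.Vh k
  add_mem' := by
    rintro v w ⟨hv0, hvb, hvn⟩ ⟨hw0, hwb, hwn⟩
    refine ⟨fun T => add_mem (hv0 T) (hw0 T),
      fun e => (polyOnSub e.1 k).add_mem (hvb e) (hwb e), fun T e he => ?_⟩
    rw [vn_add]
    refine ⟨(polyOnSub e.1 _).add_mem (hvn T e he).1 (hwn T e he).1, fun x => ?_⟩
    rw [Pi.add_apply, add_smul, ← (hvn T e he).2, ← (hwn T e he).2]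
    rfl
  zero_mem' := by
    refine ⟨fun _ => zero_mem _, fun e => (polyOnSub e.1 k).zero_mem, fun _ e _ => ?_⟩
    rw [vn_zero]
    exact ⟨(polyOnSub e.1 _).zero_mem, fun _ => (zero_smul ℝ _).symm⟩
  smul_mem' := by
    rintro c v ⟨hv0, hvb, hvn⟩
    refine ⟨fun T => Submodule.smul_mem _ c (hv0 T),
      fun e => (polyOnSub e.1 k).smul_mem c (hvb e), fun T e he => ?_⟩
    rw [vn_smul]
    refine ⟨(polyOnSub e.1 _).smul_mem c (hvn T e he).1, fun x => ?_⟩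
    rw [Pi.smul_apply, smul_assoc, ← (hvn T e he).2]
    rfl

/-- `W_h` as a vector space. -/
def WhSub (k : ℕ) : Submodule ℝ M.PiecewisePoly where
  carrier := M.Wh k
  add_mem' hv hw T := add_mem (hv T) (hw T)
  zero_mem' _ := zero_mem _
  smul_mem' c _ hv T := Submodule.smul_mem _ c (hv T)

instance finiteDimensional_VhSub (k : ℕ) : FiniteDimensional ℝ (M.VhSub k) := by
  choose! S hS heS using fun e he => M.exists_elem_of_face (e := e) he
  let L : ((M.elems → polySpace d k) × (M.faces → polySpace d k) ×
      (M.faces → polySpace d ((k : ℤ) - 1))) →ₗ[ℝ] M.WeakFunction :=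
    { toFun := fun p => (fun T => p.1 T, fun e x => evalAt (p.2.1 e).1 x,
        fun e x => evalAt (p.2.2 e).1 x • M.normal (S e.1) e.1)
      map_add' := fun p q => by
        refine Prod.ext rfl (Prod.ext ?_ ?_)
        · funext e x; simp
        · funext e x; simp [add_smul]
      map_smul' := fun c p => by
        refine Prod.ext rfl (Prod.ext ?_ ?_)
        · funext e x; simp
        · funext e x; simp [mul_smul] }
  refine Submodule.finiteDimensional_of_le (S₂ := LinearMap.range L) ?_
  rintro v ⟨hv0, hvb, hvn⟩
  have hvn' (e : M.faces) := hvn ⟨S e.1, hS e.1 e.2⟩ e (heS e.1 e.2)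
  choose pb hpb hpb' using hvb
  choose pn hpn hpn' using fun e => (hvn' e).1
  refine ⟨(fun T => ⟨v.v0 T, hv0 T⟩, fun e => ⟨pb e, hpb e⟩, fun e => ⟨pn e, hpn e⟩),
    Prod.ext rfl (Prod.ext ?_ ?_)⟩
  · funext e x
    exact (hpb' e x).symm
  · funext e x
    exact (congrArg (· • M.normal (S e.1) e.1) (hpn' e x)).symm.trans ((hvn' e).2 x).symm

instance finiteDimensional_WhSub (k : ℕ) : FiniteDimensional ℝ (M.WhSub k) :=
  Submodule.finiteDimensional_of_le
    (S₂ := LinearMap.range ((polySpace d ((k : ℤ) - 2)).subtype.compLeft M.elems))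
    fun w hw => ⟨fun T => ⟨w T, hw T⟩, rfl⟩

/-! ### Traces -/

lemma continuous_vn {k : ℕ} (v : M.VhSub k) (T : M.elems) (e : M.faces) :
    Continuous (v.1.vn T e) := by
  obtain ⟨S, hS, heS⟩ := M.exists_elem_of_face e.2
  obtain ⟨hvn, hvnn⟩ := v.2.2.2 ⟨S, hS⟩ e heS
  have hc : Continuous (v.1.vnn e) := by
    rw [funext hvnn]
    exact (continuous_of_mem_polyOn hvn).smul continuous_const
  exact hc.inner continuous_const

/-- The component `v_b` on a face. -/
def traceB (k : ℕ) (e : M.faces) : M.VhSub k →ₗ[ℝ] C(e.1, ℝ) where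
  toFun v := ⟨v.1.vb e, continuous_of_mem_polyOn (v.2.2.1 e)⟩
  map_add' _ _ := rfl
  map_smul' _ _ := rfl

/-- The component `v_n` on a face of an element. -/
def traceN (k : ℕ) (T : M.elems) (e : M.faces) : M.VhSub k →ₗ[ℝ] C(e.1, ℝ) where
  toFun v := ⟨v.1.vn T e, M.continuous_vn v T e⟩
  map_add' v w := DFunLike.coe_injective (M.vn_add v.1 w.1 T e)
  map_smul' c v := DFunLike.coe_injective (M.vn_smul c v.1 T e)

/-- The component `v₀` on an element. -/
def interiorPart (k : ℕ) (T : M.elems) : M.VhSub k →ₗ[ℝ] Poly d where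
  toFun v := v.1.v0 T
  map_add' _ _ := rfl
  map_smul' _ _ := rfl

/-- The jump `v₀ - v_b` on a face of an element. -/
def jumpB (k : ℕ) (T : M.elems) (e : M.faces) : M.VhSub k →ₗ[ℝ] C(e.1, ℝ) :=
  polyRes e.1 ∘ₗ M.interiorPart k T - M.traceB k e

/-- The jump `∇v₀ · n - v_n` on a face of an element. -/
def jumpN (k : ℕ) (T : M.elems) (e : M.faces) : M.VhSub k →ₗ[ℝ] C(e.1, ℝ) :=
  polyRes e.1 ∘ₗ (dirDerivation (M.normal T.1 e.1)).toLinearMap ∘ₗ M.interiorPart k T -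
    M.traceN k T e

variable {M} {k : ℕ}

lemma jumpB_apply (T : M.elems) (e : M.faces) (v : M.VhSub k) (x : e.1) :
    M.jumpB k T e v x = evalAt (v.1.v0 T) x - v.1.vb e x := rfl

lemma jumpN_apply (T : M.elems) (e : M.faces) (v : M.VhSub k) (x : e.1) :
    M.jumpN k T e v x = dirDeriv (v.1.v0 T) (M.normal T.1 e.1) x - v.1.vn T e x := by
  rw [← evalAt_dirDerivation]; rfl

variable (M)

lemma mem_Vh0_iff {Γd Γn : Set (Pt d)} {v : M.WeakFunction} :
    v ∈ M.Vh0 k Γd Γn ↔ v ∈ M.Vh k ∧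
      (∀ e : M.faces, IsFaceOf (Ω := Ω) Γd e.1 → v.vb e = 0) ∧
      (∀ e : M.faces, IsFaceOf (Ω := Ω) Γn e.1 →
        ∀ T : M.elems, e.1 ⊆ frontier T.1 → v.vn T e = 0) := by
  simp only [Vh0, Vhg, Set.mem_ofPred_eq, isL2Projection_zero_iff]

/-- `V_h^0` as a subspace of `V_h`. -/
def Vh0Sub (k : ℕ) (Γd Γn : Set (Pt d)) : Submodule ℝ (M.VhSub k) :=
  (⨅ (e : M.faces) (_ : IsFaceOf (Ω := Ω) Γd e.1), (M.traceB k e).ker) ⊓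
    ⨅ (e : M.faces) (_ : IsFaceOf (Ω := Ω) Γn e.1) (T : M.elems) (_ : e.1 ⊆ frontier T.1),
      (M.traceN k T e).ker

lemma mem_Vh0Sub {Γd Γn : Set (Pt d)} {v : M.VhSub k} :
    v ∈ M.Vh0Sub k Γd Γn ↔ v.1 ∈ M.Vh0 k Γd Γn := by
  have hb (e : M.faces) : M.traceB k e v = 0 ↔ v.1.vb e = 0 := DFunLike.ext'_iff
  have hn (T : M.elems) (e : M.faces) : M.traceN k T e v = 0 ↔ v.1.vn T e = 0 := DFunLike.ext'_iff
  simp only [Vh0Sub, Submodule.mem_inf, Submodule.mem_iInf, LinearMap.mem_ker, mem_Vh0_iff, hb, hn,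
    show v.1 ∈ M.Vh k from v.2, true_and]

/-! ### The bilinear forms of the scheme -/

open Classical in
/-- The stabilizer as a bilinear form. -/
def stabForm (k : ℕ) : M.VhSub k →ₗ[ℝ] M.VhSub k →ₗ[ℝ] ℝ :=
  ∑ T : M.elems,
    ((Metric.diam T.1 ^ 3)⁻¹ • ∑ e : M.faces with e.1 ⊆ frontier T.1,
        (M.faceForm e).compl₁₂ (M.jumpB k T e) (M.jumpB k T e) +
      (Metric.diam T.1)⁻¹ • ∑ e : M.faces with e.1 ⊆ frontier T.1,
        (M.faceForm e).compl₁₂ (M.jumpN k T e) (M.jumpN k T e))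

lemma stabForm_apply (u v : M.VhSub k) : M.stabForm k u v = M.stab u.1 v.1 := by
  simp only [stabForm, stab, stabT, boundaryIntegral, LinearMap.sum_apply, LinearMap.add_apply,
    LinearMap.smul_apply, LinearMap.compl₁₂_apply, faceForm_apply, jumpB_apply, jumpN_apply,
    smul_eq_mul]

open Classical in
/-- The right-hand side of the definition of the discrete weak Laplacian on `T`. -/
def weakLapForm (k : ℕ) (T : M.elems) : M.VhSub k →ₗ[ℝ] Poly d →ₗ[ℝ] ℝ :=
  (M.elemForm T).compl₁₂ (polyCont ∘ₗ M.interiorPart k T) (polyCont ∘ₗ lapLin) -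
    ∑ e : M.faces with e.1 ⊆ frontier T.1, (M.faceForm e).compl₁₂ (M.traceB k e)
      (polyRes e.1 ∘ₗ (dirDerivation (M.normal T.1 e.1)).toLinearMap) +
    ∑ e : M.faces with e.1 ⊆ frontier T.1, (M.faceForm e).compl₁₂ (M.traceN k T e) (polyRes e.1)

lemma weakLapForm_apply (T : M.elems) (v : M.VhSub k) (φ : Poly d) :
    M.weakLapForm k T v φ = (∫ x in T.1, evalAt (v.1.v0 T) x * evalAt (lap φ) x)
        - M.boundaryIntegral T.1 (fun e x => v.1.vb e x * dirDeriv φ (M.normal T.1 e.1) x)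
        + M.boundaryIntegral T.1 (fun e x => v.1.vn T e x * evalAt φ x) := by
  simp only [weakLapForm, boundaryIntegral, LinearMap.sum_apply, LinearMap.add_apply,
    LinearMap.sub_apply, LinearMap.compl₁₂_apply, LinearMap.comp_apply, faceForm_apply,
    elemForm_apply, lapLin_apply, ← evalAt_dirDerivation]
  rfl

lemma exists_isDiscreteWeakLaplacian (r : ℤ) (T : M.elems) (v : M.VhSub k) :
    ∃ q, M.IsDiscreteWeakLaplacian r T v.1 q := by
  let P : polySpace d r →ₗ[ℝ] C(Pt d, ℝ) := polyCont ∘ₗ (polySpace d r).subtype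
  have hsep : ((M.elemForm T).compl₁₂ P P).SeparatingLeft := fun q hq =>
    Subtype.ext (M.eq_zero_of_integral_mul_self_eq_zero T.2 (hq q))
  obtain ⟨q, hq, -⟩ := existsUnique_of_separatingLeft hsep
    (M.weakLapForm k T v ∘ₗ (polySpace d r).subtype)
  refine ⟨q, q.2, fun φ hφ => ?_⟩
  rw [← weakLapForm_apply]
  exact LinearMap.congr_fun hq ⟨φ, hφ⟩

lemma isDiscreteWeakLaplacian_weakLaplacian (r : ℤ) (T : M.elems) (v : M.VhSub k) :
    M.IsDiscreteWeakLaplacian r T v.1 (M.weakLaplacian r T v.1) := by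
  rw [weakLaplacian, dif_pos (M.exists_isDiscreteWeakLaplacian r T v)]
  exact (M.exists_isDiscreteWeakLaplacian r T v).choose_spec

/-- The pairing `(Δ_{w,h} v, w)` of discrete weak Laplacians with piecewise polynomials `w`, written
out so as to make sense for `w` of any degree. -/
def dualForm (k : ℕ) : M.VhSub k →ₗ[ℝ] M.PiecewisePoly →ₗ[ℝ] ℝ :=
  ∑ T : M.elems, (M.weakLapForm k T).compl₁₂ LinearMap.id (LinearMap.proj T)

lemma dualForm_apply (v : M.VhSub k) (w : M.PiecewisePoly) :
    M.dualForm k v w = ∑ T, M.weakLapForm k T v (w T) := by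
  simp [dualForm]

lemma innerPP_weakLaplacianH (v : M.VhSub k) {w : M.PiecewisePoly} (hw : w ∈ M.Wh k) :
    M.innerPP (M.weakLaplacianH k v.1) w = M.dualForm k v w := by
  rw [dualForm_apply, innerPP]
  refine Finset.sum_congr rfl fun T _ => ?_
  rw [weakLapForm_apply]
  exact (M.isDiscreteWeakLaplacian_weakLaplacian _ T v).2 (w T) (hw T)

end PolytopalMesh

namespace PolytopalMesh

variable {d : ℕ} {Ω : Set (Pt d)} (M : PolytopalMesh Ω) {k : ℕ} {Γd Γn : Set (Pt d)}

/-! ### The primal component of the homogeneous system -/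

lemma diam_elem_pos {T e : Set (Pt d)} (hT : T ∈ M.elems) (he : e ∈ M.faces)
    (heT : e ⊆ frontier T) : 0 < Metric.diam T := by
  have : Nontrivial (Pt d) := nontrivial_of_ne _ _ (M.normal_ne_zero hT he heT)
  refine Metric.diam_pos ?_ (M.isCompact_elem hT).isBounded
  by_contra h
  have hpos := isOpen_interior.measure_pos (volume : Measure (Pt d))
    (M.elem_connected T hT).nonempty
  exact hpos.ne' (((Set.not_nontrivial_iff.1 h).anti interior_subset).measure_zero _)

variable {M} in
/-- `u_b` and `u_n` are the traces of `u₀` and `∇u₀ · n` from every side: the kernel of the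
stabilizer. -/
def IsJumpFree (u : M.VhSub k) : Prop :=
  ∀ (T : M.elems) (e : M.faces), e.1 ⊆ frontier T.1 → M.jumpB k T e u = 0 ∧ M.jumpN k T e u = 0

lemma isJumpFree_of_stabForm_self_eq_zero {u : M.VhSub k} (h : M.stabForm k u u = 0) :
    IsJumpFree u := by
  classical
  intro T e he
  have hface (e : M.faces) (g : C(e.1, ℝ)) : 0 ≤ M.faceForm e g g := l2Form_self_nonneg _ g
  have hsum (J : (e : M.faces) → C(e.1, ℝ)) (S : M.elems) :
      0 ≤ ∑ e : M.faces with e.1 ⊆ frontier S.1, M.faceForm e (J e) (J e) :=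
    Finset.sum_nonneg fun e _ => hface e _
  have hB (S : M.elems) := mul_nonneg (inv_nonneg.2 (pow_nonneg (Metric.diam_nonneg (s := S.1)) 3))
    (hsum (M.jumpB k S · u) S)
  have hN (S : M.elems) := mul_nonneg (inv_nonneg.2 (Metric.diam_nonneg (s := S.1)))
    (hsum (M.jumpN k S · u) S)
  have hzero {J : (e : M.faces) → C(e.1, ℝ)}
      (hJ : ∑ e : M.faces with e.1 ⊆ frontier T.1, M.faceForm e (J e) (J e) = 0) : J e = 0 :=
    M.eq_zero_of_faceForm_self_eq_zero e
      ((Finset.sum_eq_zero_iff_of_nonneg fun e _ => hface e _).1 hJ e (by simpa using he))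
  simp only [stabForm, LinearMap.sum_apply, LinearMap.add_apply, LinearMap.smul_apply,
    LinearMap.compl₁₂_apply, smul_eq_mul] at h
  obtain ⟨hBT, hNT⟩ := (add_eq_zero_iff_of_nonneg (hB T) (hN T)).1 <|
    (Finset.sum_eq_zero_iff_of_nonneg fun S _ => add_nonneg (hB S) (hN S)).1 h T (Finset.mem_univ T)
  have hdiam := (M.diam_elem_pos T.2 e.2 he).ne'
  exact ⟨hzero ((mul_eq_zero.1 hBT).resolve_left (inv_ne_zero (pow_ne_zero 3 hdiam))),
    hzero ((mul_eq_zero.1 hNT).resolve_left (inv_ne_zero hdiam))⟩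

section IsJumpFree

variable {M} {u : M.VhSub k} (hu : IsJumpFree u) {T : M.elems} {e : M.faces}
  (heT : e.1 ⊆ frontier T.1)

include hu heT

lemma IsJumpFree.vb_eq (x : e.1) : u.1.vb e x = evalAt (u.1.v0 T) x :=
  (sub_eq_zero.1 (DFunLike.congr_fun (hu T e heT).1 x)).symm

lemma IsJumpFree.vn_eq (x : e.1) : u.1.vn T e x = dirDeriv (u.1.v0 T) (M.normal T.1 e.1) x := by
  have hjump := DFunLike.congr_fun (hu T e heT).2 x
  rw [jumpN_apply] at hjump
  exact (sub_eq_zero.1 hjump).symm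

end IsJumpFree

lemma IsJumpFree.weakLapForm_eq {u : M.VhSub k} (hu : IsJumpFree u) (T : M.elems) (φ : Poly d) :
    M.weakLapForm k T u φ = ∫ x in T.1, evalAt (lap (u.1.v0 T)) x * evalAt φ x := by
  classical
  rw [← M.green T.2, weakLapForm_apply]
  simp only [boundaryIntegral]
  congr 1
  · refine congrArg _ (Finset.sum_congr rfl fun e he => ?_)
    simp only [hu.vb_eq (Finset.mem_filter.1 he).2]
  · refine Finset.sum_congr rfl fun e he => ?_
    simp only [hu.vn_eq (Finset.mem_filter.1 he).2]

lemma eq_zero_of_sum_integral_mul_self_eq_zero {p : M.PiecewisePoly}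
    (h : ∑ T : M.elems, ∫ x in T.1, evalAt (p T) x * evalAt (p T) x = 0) (T : M.elems) : p T = 0 :=
  M.eq_zero_of_integral_mul_self_eq_zero T.2 ((Finset.sum_eq_zero_iff_of_nonneg
    (fun _ _ => integral_nonneg fun _ => mul_self_nonneg _)).1 h T (Finset.mem_univ T))

lemma IsJumpFree.lap_eq_zero {u : M.VhSub k} (hu : IsJumpFree u)
    (hw : ∀ w ∈ M.Wh k, M.dualForm k u w = 0) (T : M.elems) : lap (u.1.v0 T) = 0 := by
  refine M.eq_zero_of_sum_integral_mul_self_eq_zero (p := fun T => lap (u.1.v0 T)) ?_ T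
  rw [← hw (fun T => lap (u.1.v0 T)) fun T => lap_mem_polySpace (u.2.1 T), dualForm_apply]
  exact Finset.sum_congr rfl fun T _ => (hu.weakLapForm_eq M T _).symm

lemma dirDeriv_neg (p : Poly d) (n x : Pt d) : dirDeriv p (-n) x = -dirDeriv p n x := by
  simp [dirDeriv]

lemma vn_eq_neg (v : M.WeakFunction) (e : M.faces) {T T' : M.elems} (hne : T ≠ T')
    (heT : e.1 ⊆ frontier T.1) (heT' : e.1 ⊆ frontier T'.1) (x : e.1) :
    v.vn T' e x = -v.vn T e x := by
  simp only [WeakFunction.vn]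
  rw [M.normal_eq_neg T.2 T'.2 (Subtype.coe_ne_coe.2 hne) e.2 heT heT', inner_neg_right]

lemma IsJumpFree.cauchy_data_eq {u : M.VhSub k} (hu : IsJumpFree u) {e : M.faces} {T T' : M.elems}
    (hne : T ≠ T') (heT : e.1 ⊆ frontier T.1) (heT' : e.1 ⊆ frontier T'.1) (x : e.1) :
    evalAt (u.1.v0 T) x = evalAt (u.1.v0 T') x ∧
      dirDeriv (u.1.v0 T) (M.normal T.1 e.1) x = dirDeriv (u.1.v0 T') (M.normal T.1 e.1) x := by
  refine ⟨(hu.vb_eq heT x).symm.trans (hu.vb_eq heT' x), ?_⟩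
  have hnormal := M.normal_eq_neg T.2 T'.2 (Subtype.coe_ne_coe.2 hne) e.2 heT heT'
  have hvn := M.vn_eq_neg u.1 e hne heT heT' x
  rwa [hu.vn_eq heT, hu.vn_eq heT', hnormal, dirDeriv_neg, neg_inj, eq_comm] at hvn

lemma IsJumpFree.eq_zero_of_v0_eq_zero {u : M.VhSub k} (hu : IsJumpFree u)
    (h : ∀ T, u.1.v0 T = 0) : u = 0 := by
  have hface (e : M.faces) (x : e.1) : u.1.vb e x = 0 ∧ u.1.vnn e x = 0 := by
    obtain ⟨T, hT, heT⟩ := M.exists_elem_of_face e.2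
    constructor
    · rw [hu.vb_eq (T := ⟨T, hT⟩) heT, h, evalAt_zero]
    · rw [(u.2.2.2 ⟨T, hT⟩ e heT).2 x, hu.vn_eq (T := ⟨T, hT⟩) heT, h]
      simp [dirDeriv]
  refine Subtype.ext (Prod.ext (funext h) (Prod.ext ?_ ?_))
  · exact funext fun e => funext fun x => (hface e x).1
  · exact funext fun e => funext fun x => (hface e x).2

theorem primal_eq_zero (hΩo : IsOpen Ω) (hΩc : IsPreconnected Ω) {u : M.VhSub k}
    (hu : u ∈ M.Vh0Sub k Γd Γn) {e₀ : M.faces} (hed : IsFaceOf (Ω := Ω) Γd e₀.1)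
    (hen : IsFaceOf (Ω := Ω) Γn e₀.1) (hs : M.stabForm k u u = 0)
    (hw : ∀ w ∈ M.Wh k, M.dualForm k u w = 0) : u = 0 := by
  have hjf := M.isJumpFree_of_stabForm_self_eq_zero hs
  obtain ⟨-, hub, hun⟩ := M.mem_Vh0_iff.1 (M.mem_Vh0Sub.1 hu)
  obtain ⟨T₀, hT₀, heT₀⟩ := M.exists_elem_of_face e₀.2
  refine hjf.eq_zero_of_v0_eq_zero M (congrFun (f := u.1.1) (g := 0) ?_)
  refine M.eq_zero_of_piecewise_harmonic hΩo hΩc u.1.1 (hjf.lap_eq_zero M hw)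
    (fun e _ T T' hne heT heT' x hx => hjf.cauchy_data_eq M hne heT heT' ⟨x, hx⟩) e₀.2
    (T₀ := ⟨T₀, hT₀⟩) heT₀ (fun x hx => ?_) (fun x hx => ?_)
  · exact (hjf.vb_eq heT₀ ⟨x, hx⟩).symm.trans (congrFun (hub e₀ hed) ⟨x, hx⟩)
  · exact (hjf.vn_eq heT₀ ⟨x, hx⟩).symm.trans (congrFun (hun e₀ hen ⟨T₀, hT₀⟩ heT₀) ⟨x, hx⟩)

/-! ### The pairing with the discrete weak Laplacian, face by face -/

open Classical in
/-- The elements which contain the face `e`. -/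
def elemsOf (e : M.faces) : Finset M.elems := {T | e.1 ⊆ frontier T.1}

lemma mem_elemsOf {e : M.faces} {T : M.elems} : T ∈ M.elemsOf e ↔ e.1 ⊆ frontier T.1 := by
  simp [elemsOf]

lemma card_elemsOf (e : M.faces) :
    (M.elemsOf e).card = {T | T ∈ M.elems ∧ e.1 ⊆ frontier T}.ncard := by
  rw [← Finset.card_map (Function.Embedding.subtype _), ← Set.ncard_coe_finset]
  congr 1
  ext T
  simp [mem_elemsOf, and_comm]

open Classical in
lemma elemsOf_eq_pair {e : M.faces} (hb : ¬ e.1 ⊆ frontier Ω) {T T' : M.elems} (hne : T ≠ T')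
    (heT : e.1 ⊆ frontier T.1) (heT' : e.1 ⊆ frontier T'.1) : M.elemsOf e = {T, T'} := by
  refine (Finset.eq_of_subset_of_card_le ?_ ?_).symm
  · simp [Finset.insert_subset_iff, mem_elemsOf, heT, heT']
  · rw [card_elemsOf, M.interior_face e.1 e.2 hb, Finset.card_pair hne]

lemma elemsOf_eq_singleton {e : M.faces} (hb : e.1 ⊆ frontier Ω) {T : M.elems}
    (heT : e.1 ⊆ frontier T.1) : M.elemsOf e = {T} := by
  refine (Finset.eq_of_subset_of_card_le ?_ ?_).symm
  · simpa [mem_elemsOf] using heT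
  · rw [card_elemsOf, M.boundary_face e.1 e.2 hb, Finset.card_singleton]

lemma sum_boundaryIntegral (F : M.elems → (e : M.faces) → e.1 → ℝ) :
    ∑ T : M.elems, M.boundaryIntegral T.1 (F T) =
      ∑ e : M.faces, ∑ T ∈ M.elemsOf e, ∫ x, F T e x ∂(faceMeasure e.1) :=
  Finset.sum_comm' fun T e => by simp [mem_elemsOf]

lemma inner_normal_smul_normal {T T' e : Set (Pt d)} (hT : T ∈ M.elems) (hT' : T' ∈ M.elems)
    (he : e ∈ M.faces) (heT : e ⊆ frontier T) (heT' : e ⊆ frontier T') :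
    (inner ℝ (M.normal T e) (M.normal T' e) : ℝ) • M.normal T' e = M.normal T e := by
  obtain ⟨c, hc⟩ := Submodule.mem_span_singleton.1 (M.normal_mem_span_normal hT' hT he heT' heT)
  rw [← hc, real_inner_smul_left, real_inner_self_eq_norm_sq, M.norm_normal hT' he heT', one_pow,
    mul_one]

/-- An element which contains the face `e`. -/
def side (e : M.faces) : M.elems :=
  ⟨(M.exists_elem_of_face e.2).choose, (M.exists_elem_of_face e.2).choose_spec.1⟩

lemma face_subset_side (e : M.faces) : e.1 ⊆ frontier (M.side e).1 :=
  (M.exists_elem_of_face e.2).choose_spec.2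

/-- The sign of the outward normal of `T` on `e` relative to that of `side e`. -/
def orientation (T : M.elems) (e : M.faces) : ℝ :=
  inner ℝ (M.normal (M.side e).1 e.1) (M.normal T.1 e.1)

lemma orientation_smul_normal {T : M.elems} {e : M.faces} (heT : e.1 ⊆ frontier T.1) :
    M.orientation T e • M.normal T.1 e.1 = M.normal (M.side e).1 e.1 :=
  M.inner_normal_smul_normal (M.side e).2 T.2 e.2 (M.face_subset_side e) heT

lemma orientation_ne_zero {T : M.elems} {e : M.faces} (heT : e.1 ⊆ frontier T.1) :
    M.orientation T e ≠ 0 := fun h =>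
  M.normal_ne_zero (M.side e).2 e.2 (M.face_subset_side e) <| by
    rw [← M.orientation_smul_normal heT, h, zero_smul]

lemma orientation_side (e : M.faces) : M.orientation (M.side e) e = 1 := by
  rw [orientation, real_inner_self_eq_norm_sq,
    M.norm_normal (M.side e).2 e.2 (M.face_subset_side e), one_pow]

lemma orientation_eq_neg {T T' : M.elems} {e : M.faces} (hne : T ≠ T') (heT : e.1 ⊆ frontier T.1)
    (heT' : e.1 ⊆ frontier T'.1) : M.orientation T' e = -M.orientation T e := by
  rw [orientation, M.normal_eq_neg T.2 T'.2 (Subtype.coe_ne_coe.2 hne) e.2 heT heT',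
    inner_neg_right, orientation]

lemma vn_eq_orientation_mul (v : M.VhSub k) (T : M.elems) (e : M.faces) (x : e.1) :
    v.1.vn T e x = M.orientation T e * v.1.vn (M.side e) e x := by
  rw [WeakFunction.vn, (v.2.2.2 (M.side e) e (M.face_subset_side e)).2 x, real_inner_smul_left,
    mul_comm, orientation]

lemma exists_weakFunction {p : M.PiecewisePoly} (hp : ∀ T, p T ∈ polySpace d k)
    {qb : (e : M.faces) → e.1 → ℝ} (hqb : ∀ e, qb e ∈ polyOn e.1 k)
    {qn : (e : M.faces) → e.1 → ℝ} (hqn : ∀ e, qn e ∈ polyOn e.1 ((k : ℤ) - 1)) :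
    ∃ v : M.VhSub k, v.1.v0 = p ∧ v.1.vb = qb ∧ ∀ e, v.1.vn (M.side e) e = qn e := by
  let v : M.WeakFunction := (p, qb, fun e x => qn e x • M.normal (M.side e).1 e.1)
  have hvn (T : M.elems) (e : M.faces) : v.vn T e = M.orientation T e • qn e := by
    ext x
    exact (real_inner_smul_left _ _ _).trans (mul_comm _ _)
  refine ⟨⟨v, hp, hqb, fun T e heT => ?_⟩, rfl, rfl, fun e => ?_⟩
  · rw [hvn]
    refine ⟨(polyOnSub e.1 _).smul_mem _ (hqn e), fun x => ?_⟩
    rw [Pi.smul_apply, smul_eq_mul, mul_comm, mul_smul, M.orientation_smul_normal heT]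
    rfl
  · rw [hvn, orientation_side, one_smul]

/-- The jump of `w` across the face `e`, up to sign, or the value of `w` on a boundary face. -/
def valueJump (w : M.PiecewisePoly) (e : M.faces) : Poly d :=
  ∑ T ∈ M.elemsOf e, M.orientation T e • w T

/-- The jump of `∇w · n` across the face `e`, or the value of `∇w · n` on a boundary face. -/
def normalJump (w : M.PiecewisePoly) (e : M.faces) : Poly d :=
  ∑ T ∈ M.elemsOf e, dirDerivation (M.normal T.1 e.1) (w T)

lemma dualForm_eq_sum_faces (v : M.VhSub k) (w : M.PiecewisePoly) :
    M.dualForm k v w = (∑ T : M.elems, ∫ x in T.1, evalAt (v.1.v0 T) x * evalAt (lap (w T)) x)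
      - ∑ e : M.faces, M.faceForm e (M.traceB k e v) (polyRes e.1 (M.normalJump w e))
      + ∑ e : M.faces,
          M.faceForm e (M.traceN k (M.side e) e v) (polyRes e.1 (M.valueJump w e)) := by
  simp only [dualForm_apply, weakLapForm_apply, Finset.sum_add_distrib, Finset.sum_sub_distrib,
    sum_boundaryIntegral, valueJump, normalJump, map_sum, map_smul]
  congr 1
  · refine congrArg _ (Finset.sum_congr rfl fun e _ => Finset.sum_congr rfl fun T _ => ?_)
    simp only [← evalAt_dirDerivation]
    rfl
  · refine Finset.sum_congr rfl fun e _ => Finset.sum_congr rfl fun T _ => ?_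
    simp only [M.vn_eq_orientation_mul v T, mul_assoc, integral_const_mul]
    rfl

/-! ### The dual component of the homogeneous system -/

section Dual

variable {M} {lam : M.PiecewisePoly}

lemma polyRes_mem_polyOn {e : Set (Pt d)} {r : ℤ} {p : Poly d} (hp : p ∈ polySpace d r) :
    ⇑(polyRes e p) ∈ polyOn e r := ⟨p, hp, fun _ => rfl⟩

lemma normalJump_mem_polySpace (hlam : lam ∈ M.Wh k) (e : M.faces) :
    M.normalJump lam e ∈ polySpace d k :=
  Submodule.sum_mem _ fun T _ => polySpace_mono (by lia) (dirDerivation_mem_polySpace (hlam T) _)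

lemma valueJump_mem_polySpace (hlam : lam ∈ M.Wh k) (e : M.faces) :
    M.valueJump lam e ∈ polySpace d ((k : ℤ) - 1) :=
  Submodule.sum_mem _ fun T _ => Submodule.smul_mem _ _ (polySpace_mono (by lia) (hlam T))

open Classical in
lemma exists_jump_testFunction (hlam : lam ∈ M.Wh k) (Γd Γn : Set (Pt d)) :
    ∃ v ∈ M.Vh0Sub k Γd Γn, (∀ T, v.1.v0 T = lap (lam T)) ∧
      (∀ e, M.traceB k e v =
        if IsFaceOf (Ω := Ω) Γd e.1 then 0 else -polyRes e.1 (M.normalJump lam e)) ∧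
      ∀ e, M.traceN k (M.side e) e v =
        if IsFaceOf (Ω := Ω) Γn e.1 then 0 else polyRes e.1 (M.valueJump lam e) := by
  let qb (e : M.faces) : C(e.1, ℝ) :=
    if IsFaceOf (Ω := Ω) Γd e.1 then 0 else -polyRes e.1 (M.normalJump lam e)
  let qn (e : M.faces) : C(e.1, ℝ) :=
    if IsFaceOf (Ω := Ω) Γn e.1 then 0 else polyRes e.1 (M.valueJump lam e)
  have hp (T : M.elems) : lap (lam T) ∈ polySpace d k :=
    polySpace_mono (by lia) (lap_mem_polySpace (hlam T))
  have hqb (e : M.faces) : ⇑(qb e) ∈ polyOn e.1 k := by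
    dsimp only [qb]
    split_ifs
    · exact (polyOnSub e.1 k).zero_mem
    · exact (polyOnSub e.1 k).neg_mem (polyRes_mem_polyOn (normalJump_mem_polySpace hlam e))
  have hqn (e : M.faces) : ⇑(qn e) ∈ polyOn e.1 ((k : ℤ) - 1) := by
    dsimp only [qn]
    split_ifs
    · exact (polyOnSub e.1 _).zero_mem
    · exact polyRes_mem_polyOn (valueJump_mem_polySpace hlam e)
  obtain ⟨v, hv0, hvb, hvn⟩ := M.exists_weakFunction hp hqb hqn
  refine ⟨v, M.mem_Vh0Sub.2 (M.mem_Vh0_iff.2 ⟨v.2, fun e he => ?_, fun e he T _ => ?_⟩),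
    congrFun hv0, fun e => DFunLike.coe_injective (congrFun hvb e),
    fun e => DFunLike.coe_injective (hvn e)⟩
  · exact (congrFun hvb e).trans (by simp [qb, he])
  · ext x
    rw [M.vn_eq_orientation_mul, hvn]
    simp [qn, he]

open Classical in
/-- Testing with `v₀ = Δλ`, `v_b = -[∇λ · n]` away from `Γ_d` and `v_n = [λ]` away from `Γ_n` turns
the dual equation into a vanishing sum of squares. -/
theorem jumps_eq_zero_of_dualForm_eq_zero (hlam : lam ∈ M.Wh k)
    (h : ∀ v ∈ M.Vh0Sub k Γd Γn, M.dualForm k v lam = 0) :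
    (∀ T, lap (lam T) = 0) ∧
      (∀ e : M.faces, ¬ IsFaceOf (Ω := Ω) Γd e.1 → polyRes e.1 (M.normalJump lam e) = 0) ∧
      ∀ e : M.faces, ¬ IsFaceOf (Ω := Ω) Γn e.1 → polyRes e.1 (M.valueJump lam e) = 0 := by
  obtain ⟨v, hv, hv0, hvb, hvn⟩ := exists_jump_testFunction hlam Γd Γn
  let sq (e : M.faces) (p : Poly d) : ℝ := M.faceForm e (polyRes e.1 p) (polyRes e.1 p)
  have hsq (e : M.faces) (p : Poly d) : 0 ≤ sq e p := l2Form_self_nonneg _ _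
  have hite (P : M.faces → Prop) (p : M.faces → Poly d) (e : M.faces) :
      0 ≤ if P e then 0 else sq e (p e) := by split_ifs; exacts [le_rfl, hsq e _]
  have hsum (P : M.faces → Prop) (p : M.faces → Poly d)
      (h0 : ∑ e, (if P e then 0 else sq e (p e)) = 0) (e : M.faces) (he : ¬ P e) :
      polyRes e.1 (p e) = 0 := by
    have hsqe := (Finset.sum_eq_zero_iff_of_nonneg fun e _ => hite P p e).1 h0 e (Finset.mem_univ e)
    rw [if_neg he] at hsqe
    exact M.eq_zero_of_faceForm_self_eq_zero e hsqe
  have htest : (∑ T : M.elems, ∫ x in T.1, evalAt (lap (lam T)) x * evalAt (lap (lam T)) x)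
      + ∑ e : M.faces, (if IsFaceOf (Ω := Ω) Γd e.1 then 0 else sq e (M.normalJump lam e))
      + ∑ e : M.faces, (if IsFaceOf (Ω := Ω) Γn e.1 then 0 else sq e (M.valueJump lam e)) = 0 := by
    refine Eq.trans ?_ (h v hv)
    rw [dualForm_eq_sum_faces, sub_eq_add_neg, ← Finset.sum_neg_distrib]
    refine congrArg₂ _ (congrArg₂ _ ?_ (Finset.sum_congr rfl fun e _ => ?_))
      (Finset.sum_congr rfl fun e _ => ?_)
    · simp only [hv0]
    · rw [hvb]
      split_ifs <;> simp [sq]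
    · rw [hvn]
      split_ifs <;> simp [sq]
  have hlap : 0 ≤ ∑ T : M.elems, ∫ x in T.1, evalAt (lap (lam T)) x * evalAt (lap (lam T)) x :=
    Finset.sum_nonneg fun _ _ => integral_nonneg fun _ => mul_self_nonneg _
  have hB := Finset.sum_nonneg fun e (_ : e ∈ Finset.univ) =>
    hite (fun e => IsFaceOf (Ω := Ω) Γd e.1) (M.normalJump lam) e
  have hN := Finset.sum_nonneg fun e (_ : e ∈ Finset.univ) =>
    hite (fun e => IsFaceOf (Ω := Ω) Γn e.1) (M.valueJump lam) e
  rw [add_eq_zero_iff_of_nonneg (add_nonneg hlap hB) hN, add_eq_zero_iff_of_nonneg hlap hB] at htest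
  exact ⟨M.eq_zero_of_sum_integral_mul_self_eq_zero htest.1.1, hsum _ _ htest.1.2, hsum _ _ htest.2⟩

lemma evalAt_eq_of_valueJump_eq_zero {e : M.faces} (hb : ¬ e.1 ⊆ frontier Ω) {T T' : M.elems}
    (hne : T ≠ T') (heT : e.1 ⊆ frontier T.1) (heT' : e.1 ⊆ frontier T'.1)
    (h : polyRes e.1 (M.valueJump lam e) = 0) (x : e.1) :
    evalAt (lam T) x = evalAt (lam T') x := by
  classical
  have hx : evalAt (M.valueJump lam e) x = 0 := DFunLike.congr_fun h x
  rw [valueJump, M.elemsOf_eq_pair hb hne heT heT', Finset.sum_pair hne, evalAt_add, evalAt_smul,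
    evalAt_smul, M.orientation_eq_neg hne heT heT', neg_mul, ← sub_eq_add_neg, ← mul_sub] at hx
  exact sub_eq_zero.1 ((mul_eq_zero.1 hx).resolve_left (M.orientation_ne_zero heT))

lemma dirDeriv_eq_of_normalJump_eq_zero {e : M.faces} (hb : ¬ e.1 ⊆ frontier Ω) {T T' : M.elems}
    (hne : T ≠ T') (heT : e.1 ⊆ frontier T.1) (heT' : e.1 ⊆ frontier T'.1)
    (h : polyRes e.1 (M.normalJump lam e) = 0) (x : e.1) :
    dirDeriv (lam T) (M.normal T.1 e.1) x = dirDeriv (lam T') (M.normal T.1 e.1) x := by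
  classical
  have hx : evalAt (M.normalJump lam e) x = 0 := DFunLike.congr_fun h x
  rwa [normalJump, M.elemsOf_eq_pair hb hne heT heT', Finset.sum_pair hne, evalAt_add,
    evalAt_dirDerivation, evalAt_dirDerivation,
    M.normal_eq_neg T.2 T'.2 (Subtype.coe_ne_coe.2 hne) e.2 heT heT', dirDeriv_neg,
    ← sub_eq_add_neg, sub_eq_zero] at hx

theorem dual_eq_zero (hΩo : IsOpen Ω) (hΩc : IsPreconnected Ω) {e₀ : M.faces}
    (he₀ : e₀.1 ⊆ frontier Ω) (hed : ¬ IsFaceOf (Ω := Ω) Γd e₀.1)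
    (hen : ¬ IsFaceOf (Ω := Ω) Γn e₀.1) (hlam : lam ∈ M.Wh k)
    (h : ∀ v ∈ M.Vh0Sub k Γd Γn, M.dualForm k v lam = 0) : lam = 0 := by
  obtain ⟨hlap, hnormal, hvalue⟩ := jumps_eq_zero_of_dualForm_eq_zero hlam h
  have heT₀ := M.face_subset_side e₀
  refine M.eq_zero_of_piecewise_harmonic hΩo hΩc lam hlap
    (fun e hb T T' hne heT heT' x hx => ⟨?_, ?_⟩) e₀.2 heT₀ (fun x hx => ?_) (fun x hx => ?_)
  · exact evalAt_eq_of_valueJump_eq_zero hb hne heT heT' (hvalue e fun hf => hb hf.1) ⟨x, hx⟩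
  · exact dirDeriv_eq_of_normalJump_eq_zero hb hne heT heT' (hnormal e fun hf => hb hf.1) ⟨x, hx⟩
  · have hx₀ := DFunLike.congr_fun (hvalue e₀ hen) ⟨x, hx⟩
    rwa [valueJump, M.elemsOf_eq_singleton he₀ heT₀, Finset.sum_singleton, orientation_side,
      one_smul] at hx₀
  · have hx₀ := DFunLike.congr_fun (hnormal e₀ hed) ⟨x, hx⟩
    rw [normalJump, M.elemsOf_eq_singleton he₀ heT₀, Finset.sum_singleton] at hx₀
    exact (evalAt_dirDerivation _ _ _).symm.trans hx₀

end Dual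

end PolytopalMesh

/-! ### Boundary data -/

lemma integrableOn_of_memLp_two {X : Type*} [MeasurableSpace X] {μ : Measure X} {s : Set X}
    (hs : μ s < ⊤) {g : X → ℝ} (hg : MemLp g 2 (μ.restrict s)) : IntegrableOn g s μ := by
  have : IsFiniteMeasure (μ.restrict s) := ⟨by simpa using hs⟩
  exact hg.integrable one_le_two

namespace PolytopalMesh

variable {d : ℕ} {Ω : Set (Pt d)} (M : PolytopalMesh Ω) {k : ℕ} {Γ Γd Γn : Set (Pt d)}
  {f g g₁ g₂ : Pt d → ℝ}

include M in
lemma measure_lt_top_of_subset_frontier_domain (hΓ : Γ ⊆ frontier Ω) :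
    (μHE[d - 1] : Measure (Pt d)) Γ < ⊤ := by
  have hcover : Γ ⊆ ⋃ e ∈ M.faces, e := fun x hx => by
    obtain ⟨e, he, -, hxe⟩ := M.exists_face_of_mem_frontier_domain (hΓ hx)
    exact Set.mem_biUnion he hxe
  exact (measure_mono hcover).trans_lt
    (measure_biUnion_lt_top M.faces.finite_toSet fun e he => M.measure_face_lt_top he)

lemma exists_face_of_inter_pos (hΓd : Γd ⊆ frontier Ω) (hMd : M.Resolves Γd) (hMn : M.Resolves Γn)
    (h : 0 < (μHE[d - 1] : Measure (Pt d)) (Γd ∩ Γn)) :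
    ∃ e : M.faces, IsFaceOf (Ω := Ω) Γd e.1 ∧ IsFaceOf (Ω := Ω) Γn e.1 := by
  have hcover : Γd ∩ Γn ⊆ ⋃ e ∈ {e | e ∈ M.faces ∧ e ⊆ frontier Ω}, e ∩ (Γd ∩ Γn) := fun x hx => by
    obtain ⟨e, he, heΩ, hxe⟩ := M.exists_face_of_mem_frontier_domain (hΓd hx.1)
    exact Set.mem_biUnion (show e ∈ {e | e ∈ M.faces ∧ e ⊆ frontier Ω} from ⟨he, heΩ⟩) ⟨hxe, hx⟩
  obtain ⟨e, ⟨he, heΩ⟩, hpos⟩ : ∃ e ∈ {e | e ∈ M.faces ∧ e ⊆ frontier Ω},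
      (μHE[d - 1] : Measure (Pt d)) (e ∩ (Γd ∩ Γn)) ≠ 0 := by
    by_contra! hnull
    exact h.ne' (measure_mono_null hcover ((measure_biUnion_null_iff
      (M.faces.finite_toSet.subset fun e he => he.1).countable).2 hnull))
  refine ⟨⟨e, he⟩, ⟨heΩ, ?_⟩, ⟨heΩ, ?_⟩⟩
  · exact (hMd e he heΩ).resolve_right fun h0 => hpos <|
      measure_mono_null (Set.inter_subset_inter_right _ Set.inter_subset_left) h0
  · exact (hMn e he heΩ).resolve_right fun h0 => hpos <|
      measure_mono_null (Set.inter_subset_inter_right _ Set.inter_subset_right) h0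

lemma exists_free_face (hΓd : Γd ⊆ frontier Ω) (hΓn : Γn ⊆ frontier Ω)
    (hclosed : IsClosed (Γd ∪ Γn)) (hproper : Γd ∪ Γn ≠ frontier Ω) :
    ∃ e : M.faces, e.1 ⊆ frontier Ω ∧ ¬ IsFaceOf (Ω := Ω) Γd e.1 ∧
      ¬ IsFaceOf (Ω := Ω) Γn e.1 := by
  obtain ⟨x, hx, hxΓ⟩ : ∃ x ∈ frontier Ω, x ∉ Γd ∪ Γn := Set.not_subset.1 fun h =>
    hproper ((Set.union_subset hΓd hΓn).antisymm h)
  obtain ⟨e, he, heΩ, hxe⟩ := M.exists_face_of_mem_frontier_domain hx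
  have hpos := M.measure_face_inter_pos he hclosed.isOpen_compl ⟨x, hxe, hxΓ⟩
  have hnot {Γ : Set (Pt d)} (hΓ : Γ ⊆ Γd ∪ Γn) : ¬ IsFaceOf (Ω := Ω) Γ e := fun h => hpos.ne' <|
    measure_mono_null (Set.inter_subset_inter_right _ (Set.compl_subset_compl.2 hΓ)) h.2
  exact ⟨⟨e, he⟩, heΩ, hnot Set.subset_union_left, hnot Set.subset_union_right⟩

lemma integrableOn_of_isFaceOf {e : Set (Pt d)}
    (hg : IntegrableOn g Γ (μHE[d - 1] : Measure (Pt d))) (he : IsFaceOf (Ω := Ω) Γ e) :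
    IntegrableOn g e (μHE[d - 1] : Measure (Pt d)) :=
  hg.mono_set_ae (ae_le_set.2 he.2)

lemma exists_isL2Projection_of_isFaceOf (hg : IntegrableOn g Γ (μHE[d - 1] : Measure (Pt d)))
    (e : M.faces) (r : ℤ) :
    ∃ q ∈ polyOn e.1 r, IsFaceOf (Ω := Ω) Γ e.1 → IsL2Projection e.1 r g q := by
  by_cases he : IsFaceOf (Ω := Ω) Γ e.1
  · obtain ⟨q, hq, -⟩ := M.existsUnique_isL2Projection e r (integrableOn_of_isFaceOf hg he)
    exact ⟨q, hq.1, fun _ => hq⟩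
  · exact ⟨0, (polyOnSub e.1 r).zero_mem, fun h => absurd h he⟩

lemma nonempty_Vhg (hg₁ : IntegrableOn g₁ Γd (μHE[d - 1] : Measure (Pt d)))
    (hg₂ : IntegrableOn g₂ Γn (μHE[d - 1] : Measure (Pt d))) :
    ∃ u : M.VhSub k, u.1 ∈ M.Vhg k Γd Γn g₁ g₂ := by
  choose qb hqb hqb' using fun e => M.exists_isL2Projection_of_isFaceOf hg₁ e k
  choose qn hqn hqn' using fun e => M.exists_isL2Projection_of_isFaceOf hg₂ e ((k : ℤ) - 1)
  obtain ⟨u, -, hub, hun⟩ := M.exists_weakFunction (p := 0) (fun _ => zero_mem _) hqb hqn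
  refine ⟨u, u.2, fun e he => ?_, fun e he T heT => ?_⟩
  · rw [show u.1.vb e = qb e from congrFun hub e]
    exact hqb' e he
  · have hT := M.mem_elemsOf.2 heT
    rw [M.elemsOf_eq_singleton he.1 (M.face_subset_side e), Finset.mem_singleton] at hT
    rw [hT, hun]
    exact hqn' e he

lemma isL2Projection_iff_sub_eq_zero (e : M.faces) {r : ℤ}
    (hg : IntegrableOn g e.1 (μHE[d - 1] : Measure (Pt d))) {q q₀ : e.1 → ℝ}
    (hq₀ : IsL2Projection e.1 r g q₀) : IsL2Projection e.1 r g q ↔ q - q₀ = 0 := by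
  rw [sub_eq_zero]
  exact ⟨fun hq => (M.existsUnique_isL2Projection e r hg).unique hq hq₀, fun hq => hq ▸ hq₀⟩

lemma mem_Vhg_iff_sub_mem (hg₁ : IntegrableOn g₁ Γd (μHE[d - 1] : Measure (Pt d)))
    (hg₂ : IntegrableOn g₂ Γn (μHE[d - 1] : Measure (Pt d))) {u u₀ : M.VhSub k}
    (hu₀ : u₀.1 ∈ M.Vhg k Γd Γn g₁ g₂) :
    u.1 ∈ M.Vhg k Γd Γn g₁ g₂ ↔ u - u₀ ∈ M.Vh0Sub k Γd Γn := by
  have hvn (T : M.elems) (e : M.faces) : (u - u₀).1.vn T e = u.1.vn T e - u₀.1.vn T e := by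
    ext x; exact inner_sub_left _ _ _
  rw [mem_Vh0Sub, mem_Vh0_iff]
  refine and_congr (iff_of_true u.2 (u - u₀).2) (and_congr ?_ ?_)
  · exact forall₂_congr fun e he => M.isL2Projection_iff_sub_eq_zero e
      (integrableOn_of_isFaceOf hg₁ he) (hu₀.2.1 e he)
  · refine forall₂_congr fun e he => forall₂_congr fun T heT => ?_
    rw [hvn]
    exact M.isL2Projection_iff_sub_eq_zero e (integrableOn_of_isFaceOf hg₂ he) (hu₀.2.2 e he T heT)

/-! ### The saddle point system -/

lemma integrableOn_elem_of_integrableOn (hf : IntegrableOn f Ω) {T : Set (Pt d)}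
    (hT : T ∈ M.elems) : IntegrableOn f T := by
  refine hf.mono_set_ae (ae_le_set.2 (measure_mono_null ?_ M.volume_frontier_domain))
  have hTΩ : T ⊆ closure Ω := by
    rw [← M.iUnion_elems]
    exact Set.subset_biUnion_of_mem (u := id) hT
  exact fun x hx => ⟨hTΩ hx.1, fun h => hx.2 (interior_subset h)⟩

/-- The functional `w ↦ (f, w)`. -/
def loadForm (hf : IntegrableOn f Ω) : M.PiecewisePoly →ₗ[ℝ] ℝ :=
  ∑ T : M.elems, integralMul (μ := volume.restrict T.1) f
    (fun φ => (M.integrableOn_elem_of_integrableOn hf T.2).mul_continuousOn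
      φ.continuous.continuousOn (M.isCompact_elem T.2)) ∘ₗ polyCont ∘ₗ LinearMap.proj T

lemma loadForm_apply (hf : IntegrableOn f Ω) (w : M.PiecewisePoly) :
    M.loadForm hf w = M.load f w := by
  simp only [loadForm, LinearMap.sum_apply]
  rfl

/-- The sum of the left-hand sides of the two equations of the scheme, as a bilinear form of
`(u, lam)` and `(v, w)`. -/
def saddleForm (k : ℕ) :
    (M.VhSub k × M.PiecewisePoly) →ₗ[ℝ] (M.VhSub k × M.PiecewisePoly) →ₗ[ℝ] ℝ :=
  (M.stabForm k).compl₁₂ (LinearMap.fst ℝ _ _) (LinearMap.fst ℝ _ _) +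
    (M.dualForm k).flip.compl₁₂ (LinearMap.snd ℝ _ _) (LinearMap.fst ℝ _ _) +
    (M.dualForm k).compl₁₂ (LinearMap.fst ℝ _ _) (LinearMap.snd ℝ _ _)

lemma saddleForm_apply (x y : M.VhSub k × M.PiecewisePoly) :
    M.saddleForm k x y = M.stabForm k x.1 y.1 + M.dualForm k y.1 x.2 + M.dualForm k x.1 y.2 := rfl

/-- The test space `V_h^0 × W_h`. -/
abbrev testSpace (k : ℕ) (Γd Γn : Set (Pt d)) : Submodule ℝ (M.VhSub k × M.PiecewisePoly) :=
  (M.Vh0Sub k Γd Γn).prod (M.WhSub k)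

instance finiteDimensional_testSpace (k : ℕ) (Γd Γn : Set (Pt d)) :
    FiniteDimensional ℝ (M.testSpace k Γd Γn) :=
  Module.Finite.iff_fg.2 (Submodule.FG.prod (Module.Finite.iff_fg.1 inferInstance)
    (Module.Finite.iff_fg.1 inferInstance))

theorem separatingLeft_saddleForm (hΩo : IsOpen Ω) (hΩc : IsPreconnected Ω)
    (hcauchy : ∃ e : M.faces, IsFaceOf (Ω := Ω) Γd e.1 ∧ IsFaceOf (Ω := Ω) Γn e.1)
    (hfree : ∃ e : M.faces, e.1 ⊆ frontier Ω ∧ ¬ IsFaceOf (Ω := Ω) Γd e.1 ∧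
      ¬ IsFaceOf (Ω := Ω) Γn e.1) :
    ((M.saddleForm k).domRestrict₁₂ (M.testSpace k Γd Γn)
      (M.testSpace k Γd Γn)).SeparatingLeft := by
  obtain ⟨e₀, he₀d, he₀n⟩ := hcauchy
  obtain ⟨e₁, he₁, he₁d, he₁n⟩ := hfree
  rintro ⟨⟨u, lam⟩, hu, hlam⟩ h
  have htest (v : M.VhSub k) (hv : v ∈ M.Vh0Sub k Γd Γn) (w : M.PiecewisePoly)
      (hw : w ∈ M.WhSub k) : M.stabForm k u v + M.dualForm k v lam + M.dualForm k u w = 0 :=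
    h ⟨(v, w), Submodule.mem_prod.2 ⟨hv, hw⟩⟩
  have hs : M.stabForm k u u = 0 := by
    simpa using htest u hu (-lam) ((M.WhSub k).neg_mem hlam)
  have hprimal (w : M.PiecewisePoly) (hw : w ∈ M.Wh k) : M.dualForm k u w = 0 := by
    simpa using htest 0 (Submodule.zero_mem _) w hw
  obtain rfl : u = 0 := M.primal_eq_zero hΩo hΩc hu he₀d he₀n hs hprimal
  have hdual (v : M.VhSub k) (hv : v ∈ M.Vh0Sub k Γd Γn) : M.dualForm k v lam = 0 := by
    simpa using htest v hv 0 (Submodule.zero_mem _)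
  obtain rfl : lam = 0 := dual_eq_zero hΩo hΩc he₁ he₁d he₁n hlam hdual
  rfl

lemma isSolution_iff {u : M.VhSub k} {lam : M.PiecewisePoly} :
    M.IsSolution k Γd Γn f g₁ g₂ u.1 lam ↔
      u.1 ∈ M.Vhg k Γd Γn g₁ g₂ ∧ lam ∈ M.Wh k ∧
        ∀ y ∈ M.testSpace k Γd Γn, M.saddleForm k (u, lam) y = M.load f y.2 := by
  constructor
  · rintro ⟨hu, hlam, hdual, hprimal⟩
    refine ⟨hu, hlam, fun y hy => ?_⟩
    have hdual := hdual y.1.1 (M.mem_Vh0Sub.1 hy.1)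
    have hprimal := hprimal y.2 hy.2
    rw [M.innerPP_weakLaplacianH y.1 hlam, ← M.stabForm_apply] at hdual
    rw [M.innerPP_weakLaplacianH u hy.2] at hprimal
    rw [saddleForm_apply, hdual, hprimal, zero_add]
  · rintro ⟨hu, hlam, h⟩
    refine ⟨hu, hlam, fun v hv => ?_, fun w hw => ?_⟩
    · have hv0 := h (⟨v, hv.1⟩, 0) ⟨M.mem_Vh0Sub.2 hv, Submodule.zero_mem _⟩
      rw [M.innerPP_weakLaplacianH ⟨v, hv.1⟩ hlam, ← M.stabForm_apply u ⟨v, hv.1⟩]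
      simpa [saddleForm_apply, load] using hv0
    · have h0w := h (0, w) ⟨Submodule.zero_mem _, hw⟩
      rw [M.innerPP_weakLaplacianH u hw]
      simpa [saddleForm_apply] using h0w

lemma isSolution_iff_sub_mem (hf : IntegrableOn f Ω)
    (hg₁ : IntegrableOn g₁ Γd (μHE[d - 1] : Measure (Pt d)))
    (hg₂ : IntegrableOn g₂ Γn (μHE[d - 1] : Measure (Pt d))) {u₀ : M.VhSub k}
    (hu₀ : u₀.1 ∈ M.Vhg k Γd Γn g₁ g₂) (x : M.VhSub k × M.PiecewisePoly) :
    M.IsSolution k Γd Γn f g₁ g₂ x.1.1 x.2 ↔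
      x - (u₀, 0) ∈ M.testSpace k Γd Γn ∧ ∀ y ∈ M.testSpace k Γd Γn,
        M.saddleForm k (x - (u₀, 0)) y =
          M.loadForm hf y.2 - M.saddleForm k (u₀, 0) y := by
  rw [isSolution_iff, M.mem_Vhg_iff_sub_mem hg₁ hg₂ hu₀, ← and_assoc]
  refine and_congr ?_ (forall₂_congr fun y _ => ?_)
  · rw [Submodule.mem_prod, Prod.snd_sub, sub_zero]
    rfl
  · rw [map_sub, LinearMap.sub_apply, sub_left_inj, loadForm_apply]

end PolytopalMesh

end PDWG

end

theorem theorem3p1_general {d : ℕ} {Ω : Set (PDWG.Pt d)} (hΩ_open : IsOpen Ω)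
    (hΩ_conn : IsPreconnected Ω) (M : PDWG.PolytopalMesh Ω) (k : ℕ) {Γd Γn : Set (PDWG.Pt d)}
    {f g₁ g₂ : PDWG.Pt d → ℝ} (hf : IntegrableOn f Ω)
    (hg₁ : IntegrableOn g₁ Γd (μHE[d - 1] : Measure (PDWG.Pt d)))
    (hg₂ : IntegrableOn g₂ Γn (μHE[d - 1] : Measure (PDWG.Pt d)))
    (hCauchy : ∃ e : M.faces, PDWG.PolytopalMesh.IsFaceOf (Ω := Ω) Γd e.1 ∧
      PDWG.PolytopalMesh.IsFaceOf (Ω := Ω) Γn e.1)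
    (hfree : ∃ e : M.faces, e.1 ⊆ frontier Ω ∧ ¬ PDWG.PolytopalMesh.IsFaceOf (Ω := Ω) Γd e.1 ∧
      ¬ PDWG.PolytopalMesh.IsFaceOf (Ω := Ω) Γn e.1) :
    ∃! p : M.WeakFunction × M.PiecewisePoly, M.IsSolution k Γd Γn f g₁ g₂ p.1 p.2 := by
  let X := M.testSpace k Γd Γn
  obtain ⟨u₀, hu₀⟩ := M.nonempty_Vhg (k := k) hg₁ hg₂
  have hiff := M.isSolution_iff_sub_mem hf hg₁ hg₂ hu₀
  have hsep := M.separatingLeft_saddleForm (k := k) hΩ_open hΩ_conn hCauchy hfree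
  let l : Module.Dual ℝ X :=
    (M.loadForm hf ∘ₗ LinearMap.snd ℝ (M.VhSub k) M.PiecewisePoly - M.saddleForm k (u₀, 0)) ∘ₗ
      X.subtype
  obtain ⟨x, hx, huniq⟩ := PDWG.existsUnique_of_separatingLeft (V := X) hsep l
  refine ⟨((x.1 + (u₀, 0)).1.1, (x.1 + (u₀, 0)).2), (hiff (x.1 + (u₀, 0))).2 ?_, fun p hp => ?_⟩
  · rw [add_sub_cancel_right]
    exact ⟨x.2, fun y hy => LinearMap.congr_fun hx ⟨y, hy⟩⟩
  · obtain ⟨hmem, heq⟩ := (hiff (⟨p.1, hp.u_mem.1⟩, p.2)).1 hp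
    rw [← huniq ⟨_, hmem⟩ (LinearMap.ext fun y => heq y.1 y.2), sub_add_cancel]

theorem theorem3p1 (d : ℕ) (hd : d = 2 ∨ d = 3)
    (Ω : Set (PDWG.Pt d)) (hΩ_open : IsOpen Ω) (hΩ_bdd : Bornology.IsBounded Ω)
    (hΩ_conn : IsConnected Ω)
    (M : PDWG.PolytopalMesh Ω) (k : ℕ) (hk : 1 ≤ k)
    (Γd Γn : Set (PDWG.Pt d)) (hΓd : Γd ⊆ frontier Ω) (hΓn : Γn ⊆ frontier Ω)
    (hMd : M.Resolves Γd) (hMn : M.Resolves Γn)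
    (f g₁ g₂ : PDWG.Pt d → ℝ)
    (hf : MemLp f 2 (volume.restrict Ω))
    (hg₁ : MemLp g₁ 2 ((μHE[d - 1] : Measure (PDWG.Pt d)).restrict Γd))
    (hg₂ : MemLp g₂ 2 ((μHE[d - 1] : Measure (PDWG.Pt d)).restrict Γn))
    (hCauchy : 0 < (μHE[d - 1] : Measure (PDWG.Pt d)) (Γd ∩ Γn))
    (hclosed : IsClosed (Γd ∪ Γn)) (hproper : Γd ∪ Γn ≠ frontier Ω) :
    ∃! p : M.WeakFunction × M.PiecewisePoly,
      M.IsSolution k Γd Γn f g₁ g₂ p.1 p.2 :=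
  theorem3p1_general hΩ_open hΩ_conn.isPreconnected M k
    (PDWG.integrableOn_of_memLp_two hΩ_bdd.measure_lt_top hf)
    (PDWG.integrableOn_of_memLp_two (M.measure_lt_top_of_subset_frontier_domain hΓd) hg₁)
    (PDWG.integrableOn_of_memLp_two (M.measure_lt_top_of_subset_frontier_domain hΓn) hg₂)
    (M.exists_face_of_inter_pos hΓd hMd hMn hCauchy)
    (M.exists_free_face hΓd hΓn hclosed hproper)
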